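/- Let $\mathbb T\subset\mathbb R$ be a regular time scale (a nonempty closed set whose jump operators $\sigma(x)=\inf\{y\in\mathbb T:y>x\}$ and $\rho(x)=\sup\{y\in\mathbb T:y<x\}$, with $\sigma(\max\mathbb T)=\max\mathbb T$ and $\rho(\min\mathbb T)=\min\mathbb T$, are inverse to each other), let $\mu(x)=\sigma(x)-x$, $(Ef)(x)=f(\sigma(x))$, let $\Delta$ be the delta derivative, $\Delta f(x)=\lim_{s\to x}\frac{f(\sigma(x))-f(s)}{\sigma(x)-s}$, and let $\mathbb K=\mathbb R$ or $\mathbb C$. Call $f:\mathbb T\to\mathbb K$ smooth if every finite string of the operators $\Delta,E,E^{-1}$ can be applied to it. Let $\mathcal G$ be the algebra of formal series $\sum_{i\le m}u_i\delta^i$ ($m\in\mathbb Z$) with smooth coefficients and the multiplication determined by $\delta f=\Delta f+E(f)\,\delta$, so that $\delta^{-1}f=\sum_{k\ge0}(-1)^k\big((E^{-1}\Delta)^kE^{-1}f\big)\delta^{-k-1}$; for $P=\sum_i p_i\delta^i$ put $P_{\ge k}=\sum_{i\ge k}p_i\delta^i$. For a differential operator $A=\sum_{i\ge0}a_i\delta^i$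 (finite sum) put $A[f]=\sum_i a_i\Delta^if$ and $A^\dagger[f]=\sum_i(-\Delta E^{-1})^i(a_if)$. Let $N\ge1$ and $n\ge1$. Let $L$ depend on a time $t=t_n$ in an open interval and have one of the forms $$k=0:\quad L=c_N\delta^N+\tilde u_{N-1}\delta^{N-1}+u_{N-2}\delta^{N-2}+\dots+u_0+\sum_s\psi_s\delta^{-1}\varphi_s,$$ $$k=1:\quad L=\tilde u_N\delta^N+u_{N-1}\delta^{N-1}+\dots+u_0+\delta^{-1}u_{-1}+\sum_s\psi_s\delta^{-1}\varphi_s,$$ with finite sums over $s$, smooth fields that are differentiable in $t$, and $c_N$ independent of $t$. Let $L^{1/N}\in\mathcal G$ be, at each time, an element of order at most $1$ with $(L^{1/N})^N=L$, put $L^{n/N}=(L^{1/N})^n$ and $A=(L^{n/N})_{\ge k}$. Suppose that the Lax equation $$\frac{dL}{dt_n}=[A,L]$$ holds as an equation between finite-field operators, that is, the two sides agree in $\mathcal G$, and their nonlocal parts agree as formal expressions $\sum_j a_j\delta^{-1}b_j$, $\mathbb K$-bilinear in $(a_j,b_j)$: for all $x,y\in\mathbb T$, $$\frac{d}{dt_n}\Big(\epsilon\,u_{-1}(y)+\sum_s\psi_s(x)\varphi_s(y)\Big)=-\epsilon\,A^\dagger[u_{-1}](y)+\sum_s\Big(A[\psi_s](x)\,\varphi_s(y)-\psi_s(x)\,A^\dagger[\varphi_s](y)\Big),$$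 where $\epsilon=0$ for $k=0$ and $\epsilon=1$ for $k=1$. (The second condition holds, for instance, if $\frac{d\psi_s}{dt_n}=A[\psi_s]$, $\frac{d\varphi_s}{dt_n}=-A^\dagger[\varphi_s]$ and, for $k=1$, $\frac{du_{-1}}{dt_n}=-A^\dagger[u_{-1}]$.) (i) If $k=0$, then at all points of $\mathbb T$ and at all times $$\frac{d\tilde u_{N-1}}{dt_n}+\sum_{i=0}^{N-2}(-\mu)^{N-1-i}\frac{du_i}{dt_n}+(-\mu)^{N}\sum_s\frac{d(\psi_s\varphi_s)}{dt_n}=0,$$ and hence $$\tilde u_{N-1}+\sum_{i=0}^{N-2}(-\mu)^{N-1-i}u_i+(-\mu)^{N}\sum_s\psi_s\varphi_s=a_n$$ for a function $a_n:\mathbb T\to\mathbb K$ that does not depend on $t_n$. (ii) If $k=1$, then at all points of $\mathbb T$ and at all times $$\frac{d\tilde u_{N}}{dt_n}+\sum_{i=-1}^{N-1}(-\mu)^{N-i}\frac{du_i}{dt_n}+(-\mu)^{N+1}\sum_s\frac{d(\psi_s\varphi_s)}{dt_n}=0,$$ and hence $$\tilde u_{N}+\sum_{i=-1}^{N-1}(-\mu)^{N-i}u_i+(-\mu)^{N+1}\sum_s\psi_s\varphi_s=a_n$$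 for a function $a_n:\mathbb T\to\mathbb K$ that does not depend on $t_n$. -/

import Mathlib

open Filter Topology

namespace TimeScale

noncomputable section

/-! ### Time scales -/

/-- Forward jump `σ(x) = inf {y ∈ T : y > x}`, with `σ(max T) = max T`. -/
def fwdJump (T : Set ℝ) (x : ℝ) : ℝ :=
  open Classical in if {y | y ∈ T ∧ x < y}.Nonempty then sInf {y | y ∈ T ∧ x < y} else x

/-- Backward jump `ρ(x) = sup {y ∈ T : y < x}`, with `ρ(min T) = min T`. -/
def bwdJump (T : Set ℝ) (x : ℝ) : ℝ :=
  open Classical in if {y | y ∈ T ∧ y < x}.Nonempty then sSup {y | y ∈ T ∧ y < x} else x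

/-- A regular time scale: a nonempty closed set of reals on which `σ ∘ ρ = id = ρ ∘ σ`. -/
structure Regular where
  carrier : Set ℝ
  isClosed : IsClosed carrier
  nonempty : carrier.Nonempty
  fwd_bwd : ∀ x ∈ carrier, fwdJump carrier (bwdJump carrier x) = x
  bwd_fwd : ∀ x ∈ carrier, bwdJump carrier (fwdJump carrier x) = x

theorem fwdJump_mem {T : Set ℝ} (hT : IsClosed T) {x : ℝ} (hx : x ∈ T) : fwdJump T x ∈ T := by
  unfold fwdJump
  split_ifs with h
  · have h1 := csInf_mem_closure h ⟨x, fun y hy => hy.2.le⟩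
    exact hT.closure_subset_iff.2 (fun y hy => hy.1) h1
  · exact hx

theorem bwdJump_mem {T : Set ℝ} (hT : IsClosed T) {x : ℝ} (hx : x ∈ T) : bwdJump T x ∈ T := by
  unfold bwdJump
  split_ifs with h
  · have h1 := csSup_mem_closure h ⟨x, fun y hy => hy.2.le⟩
    exact hT.closure_subset_iff.2 (fun y hy => hy.1) h1
  · exact hx

/-- The points of a time scale. -/
abbrev Regular.Pt (T : Regular) : Type := T.carrier

/-- The forward jump of a regular time scale, as a bijection whose inverse is the backward jump. -/
def σ (T : Regular) : T.Pt ≃ T.Pt where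
  toFun x := ⟨fwdJump T.carrier x, fwdJump_mem T.isClosed x.2⟩
  invFun x := ⟨bwdJump T.carrier x, bwdJump_mem T.isClosed x.2⟩
  left_inv x := Subtype.ext (T.bwd_fwd x x.2)
  right_inv x := Subtype.ext (T.fwd_bwd x x.2)

/-- The graininess `μ(x) = σ(x) - x`. -/
def μ {T : Regular} (x : T.Pt) : ℝ := (σ T x : ℝ) - x

/-! ### The delta derivative -/

section Delta

variable {T : Regular} {𝕜 : Type*} [RCLike 𝕜]

/-- The filter `s → x`, `s ∈ T`, `s ≠ σ(x)` of the limit that defines the delta derivative. -/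
def deltaFilter (x : T.Pt) : Filter T.Pt := 𝓝[{σ T x}ᶜ] x

/-- `f` has delta derivative `d` at `x`:
`(f(σ(x)) - f(s)) / (σ(x) - s) → d` as `s → x` in `T`. -/
def HasDelta (f : T.Pt → 𝕜) (x : T.Pt) (d : 𝕜) : Prop :=
  Tendsto (fun s : T.Pt => (f (σ T x) - f s) / (((σ T x : ℝ) - (s : ℝ) : ℝ) : 𝕜))
    (deltaFilter x) (𝓝 d)

/-- `f` is delta differentiable (at every point of `T`). -/
def DeltaDiff (f : T.Pt → 𝕜) : Prop := ∀ x, ∃ d, HasDelta f x d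

/-- The delta derivative as a function. The filter is trivial only if `T` is a single point; there
the derivative is taken to be `0`. -/
def rawDelta (f : T.Pt → 𝕜) (x : T.Pt) : 𝕜 :=
  open Classical in
  if h : (deltaFilter x).NeBot ∧ ∃ d, HasDelta f x d then h.2.choose else 0

theorem rawDelta_spec {f : T.Pt → 𝕜} (hf : DeltaDiff f) (x : T.Pt) :
    HasDelta f x (rawDelta f x) := by
  unfold rawDelta
  split_ifs with h
  · exact h.2.choose_spec
  · have h1 : deltaFilter x = ⊥ := by
      by_contra h2
      exact h ⟨⟨h2⟩, hf x⟩
    unfold HasDelta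
    rw [h1]
    exact tendsto_bot

theorem rawDelta_eq {f : T.Pt → 𝕜} {x : T.Pt} {d : 𝕜} (hd : HasDelta f x d)
    (h0 : ¬ (deltaFilter x).NeBot → d = 0) : rawDelta f x = d := by
  unfold rawDelta
  split_ifs with h
  · have := h.1
    exact tendsto_nhds_unique h.2.choose_spec hd
  · symm
    apply h0
    intro h1
    exact h ⟨h1, d, hd⟩

theorem rawDelta_bot {f : T.Pt → 𝕜} {x : T.Pt} (h0 : ¬ (deltaFilter x).NeBot) :
    rawDelta f x = 0 := by
  unfold rawDelta
  rw [dif_neg (fun h => h0 h.1)]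

theorem HasDelta.tendsto {f : T.Pt → 𝕜} {x : T.Pt} {d : 𝕜} (hd : HasDelta f x d) :
    Tendsto f (deltaFilter x) (𝓝 (f x)) := by
  have h1 : Tendsto (fun s : T.Pt => (((σ T x : ℝ) - (s : ℝ) : ℝ) : 𝕜)) (deltaFilter x)
      (𝓝 (((σ T x : ℝ) - (x : ℝ) : ℝ) : 𝕜)) := by
    have : Continuous (fun s : T.Pt => (((σ T x : ℝ) - (s : ℝ) : ℝ) : 𝕜)) := by fun_prop
    exact (this.tendsto x).mono_left nhdsWithin_le_nhds
  have h2 := (tendsto_const_nhds (x := f (σ T x))).sub (hd.mul h1)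
  have h3 : Tendsto f (deltaFilter x) (𝓝 (f (σ T x) - d * (((σ T x : ℝ) - (x : ℝ) : ℝ) : 𝕜))) := by
    refine h2.congr' ?_
    have h4 : ∀ᶠ s in deltaFilter x, s ∈ ({σ T x}ᶜ : Set T.Pt) := self_mem_nhdsWithin
    filter_upwards [h4] with s hs
    have h5 : (((σ T x : ℝ) - (s : ℝ) : ℝ) : 𝕜) ≠ 0 := by
      rw [RCLike.ofReal_ne_zero, sub_ne_zero]
      intro h
      exact hs (Subtype.ext h.symm)
    field_simp
    ring
  by_cases hx : x = σ T x
  · rw [← hx] at h3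
    simpa using h3
  · have h6 : pure x ≤ deltaFilter x := by
      unfold deltaFilter
      exact pure_le_nhdsWithin hx
    have h7 := h3.mono_left h6
    have h8 : Tendsto f (pure x) (𝓝 (f x)) := tendsto_pure_nhds f x
    have h9 := tendsto_nhds_unique h8 h7
    rwa [← h9] at h3

theorem HasDelta.add {f g : T.Pt → 𝕜} {x : T.Pt} {a b : 𝕜} (hf : HasDelta f x a)
    (hg : HasDelta g x b) : HasDelta (f + g) x (a + b) := by
  refine (Tendsto.add hf hg).congr fun s => ?_
  simp only [Pi.add_apply]
  ring

theorem HasDelta.mul {f g : T.Pt → 𝕜} {x : T.Pt} {a b : 𝕜} (hf : HasDelta f x a)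
    (hg : HasDelta g x b) : HasDelta (f * g) x (a * g x + f (σ T x) * b) := by
  refine ((Tendsto.mul hf hg.tendsto).add
    ((tendsto_const_nhds (x := f (σ T x))).mul hg)).congr fun s => ?_
  simp only [Pi.mul_apply]
  ring

theorem hasDelta_const (c : 𝕜) (x : T.Pt) : HasDelta (fun _ => c) x 0 := by
  unfold HasDelta
  simpa using tendsto_const_nhds

theorem rawDelta_add {f g : T.Pt → 𝕜} (hf : DeltaDiff f) (hg : DeltaDiff g) :
    rawDelta (f + g) = rawDelta f + rawDelta g := by
  funext x
  refine rawDelta_eq ((rawDelta_spec hf x).add (rawDelta_spec hg x)) fun h => ?_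
  simp [rawDelta_bot h]

theorem rawDelta_mul {f g : T.Pt → 𝕜} (hf : DeltaDiff f) (hg : DeltaDiff g) :
    rawDelta (f * g) = rawDelta f * g + (f ∘ σ T) * rawDelta g := by
  funext x
  refine rawDelta_eq ((rawDelta_spec hf x).mul (rawDelta_spec hg x)) fun h => ?_
  simp [rawDelta_bot h]

theorem rawDelta_const (c : 𝕜) : rawDelta (fun _ : T.Pt => c) = fun _ => 0 := by
  funext x
  exact rawDelta_eq (hasDelta_const c x) fun _ => rfl

/-! ### Smooth functions -/

/-- All strings of at most `n` letters `Δ`, `E`, `E⁻¹` can be applied to `f`. -/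
def SmoothN : ℕ → (T.Pt → 𝕜) → Prop
  | 0, _ => True
  | n + 1, f => DeltaDiff f ∧ SmoothN n (rawDelta f) ∧ SmoothN n (f ∘ σ T) ∧
      SmoothN n (f ∘ (σ T).symm)

theorem SmoothN.pred : ∀ {n : ℕ} {f : T.Pt → 𝕜}, SmoothN (n + 1) f → SmoothN n f
  | 0, _, _ => trivial
  | _ + 1, _, h => ⟨h.1, h.2.1.pred, h.2.2.1.pred, h.2.2.2.pred⟩

theorem SmoothN.add : ∀ {n : ℕ} {f g : T.Pt → 𝕜}, SmoothN n f → SmoothN n g → SmoothN n (f + g)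
  | 0, _, _, _, _ => trivial
  | n + 1, f, g, hf, hg => by
    refine ⟨fun x => ⟨_, (rawDelta_spec hf.1 x).add (rawDelta_spec hg.1 x)⟩, ?_, ?_, ?_⟩
    · rw [rawDelta_add hf.1 hg.1]
      exact SmoothN.add hf.2.1 hg.2.1
    · exact SmoothN.add hf.2.2.1 hg.2.2.1
    · exact SmoothN.add hf.2.2.2 hg.2.2.2

theorem SmoothN.mul : ∀ {n : ℕ} {f g : T.Pt → 𝕜}, SmoothN n f → SmoothN n g → SmoothN n (f * g)
  | 0, _, _, _, _ => trivial
  | n + 1, f, g, hf, hg => by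
    refine ⟨fun x => ⟨_, (rawDelta_spec hf.1 x).mul (rawDelta_spec hg.1 x)⟩, ?_, ?_, ?_⟩
    · rw [rawDelta_mul hf.1 hg.1]
      exact SmoothN.add (SmoothN.mul hf.2.1 hg.pred) (SmoothN.mul hf.2.2.1 hg.2.1)
    · exact SmoothN.mul hf.2.2.1 hg.2.2.1
    · exact SmoothN.mul hf.2.2.2 hg.2.2.2

theorem SmoothN.const : ∀ (n : ℕ) (c : 𝕜), SmoothN n (fun _ : T.Pt => c)
  | 0, _ => trivial
  | n + 1, c => by
    refine ⟨fun x => ⟨_, hasDelta_const c x⟩, ?_, SmoothN.const n c, SmoothN.const n c⟩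
    rw [rawDelta_const]
    exact SmoothN.const n 0

end Delta

/-- The algebra of smooth functions `T → 𝕜`: the functions to which every finite string of the
operators `Δ`, `E` and `E⁻¹` can be applied, that is, the largest set of delta differentiable
functions that is stable under these operators. -/
def Smooth (T : Regular) (𝕜 : Type*) [RCLike 𝕜] : Subalgebra 𝕜 (T.Pt → 𝕜) where
  carrier := {f | ∀ n, SmoothN n f}
  mul_mem' hf hg n := (hf n).mul (hg n)
  add_mem' hf hg n := (hf n).add (hg n)
  algebraMap_mem' c n := SmoothN.const n c

section Operators

variable {T : Regular} {𝕜 : Type*} [RCLike 𝕜]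

/-- The shift `(E f)(x) = f(σ(x))`. -/
def E (f : Smooth T 𝕜) : Smooth T 𝕜 := ⟨f.1 ∘ σ T, fun n => (f.2 (n + 1)).2.2.1⟩

/-- The inverse shift `(E⁻¹ f)(x) = f(ρ(x))`. -/
def Einv (f : Smooth T 𝕜) : Smooth T 𝕜 := ⟨f.1 ∘ (σ T).symm, fun n => (f.2 (n + 1)).2.2.2⟩

/-- The delta derivative. -/
def Δ (f : Smooth T 𝕜) : Smooth T 𝕜 := ⟨rawDelta f.1, fun n => (f.2 (n + 1)).2.1⟩

theorem E_zero : E (0 : Smooth T 𝕜) = 0 := rfl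

theorem Einv_zero : Einv (0 : Smooth T 𝕜) = 0 := rfl

theorem Δ_zero : Δ (0 : Smooth T 𝕜) = 0 := Subtype.ext (rawDelta_const 0)

/-! ### Formal Laurent series of `δ`-differential operators -/

/-- The coefficients of `δⁿ f = ∑ₖ leibPos n k f δⁿ⁻ᵏ`, from `δ f = E(f) δ + Δ f`. -/
def leibPos : ℕ → ℕ → Smooth T 𝕜 → Smooth T 𝕜
  | 0, 0, f => f
  | 0, _ + 1, _ => 0
  | n + 1, 0, f => E (leibPos n 0 f)
  | n + 1, k + 1, f => E (leibPos n (k + 1) f) + Δ (leibPos n k f)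

/-- The coefficients of `δ⁻ⁿ f = ∑ₖ leibNeg n k f δ⁻ⁿ⁻ᵏ`, from
`δ⁻¹ f = ∑ⱼ (-1)ʲ ((E⁻¹Δ)ʲ E⁻¹ f) δ⁻¹⁻ʲ`. -/
def leibNeg : ℕ → ℕ → Smooth T 𝕜 → Smooth T 𝕜
  | 0, 0, f => f
  | 0, _ + 1, _ => 0
  | n + 1, k, f => ∑ j ∈ Finset.range (k + 1),
      leibNeg n (k - j) ((-1) ^ j * (fun g => Einv (Δ g))^[j] (Einv f))

/-- The coefficients of `δⁱ f = ∑ₖ leib i k f δⁱ⁻ᵏ` for an integer `i`. -/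
def leib : ℤ → ℕ → Smooth T 𝕜 → Smooth T 𝕜
  | Int.ofNat n, k, f => leibPos n k f
  | Int.negSucc n, k, f => leibNeg (n + 1) k f

theorem leibPos_zero : ∀ n k : ℕ, leibPos n k (0 : Smooth T 𝕜) = 0
  | 0, 0 => rfl
  | 0, _ + 1 => rfl
  | n + 1, 0 => by rw [leibPos, leibPos_zero n 0, E_zero]
  | n + 1, k + 1 => by
    rw [leibPos, leibPos_zero n (k + 1), leibPos_zero n k, E_zero, Δ_zero, add_zero]

theorem leibNeg_zero : ∀ n k : ℕ, leibNeg n k (0 : Smooth T 𝕜) = 0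
  | 0, 0 => rfl
  | 0, _ + 1 => rfl
  | n + 1, k => by
    rw [leibNeg]
    refine Finset.sum_eq_zero fun j _ => ?_
    have h : (fun g : Smooth T 𝕜 => Einv (Δ g))^[j] (Einv 0) = 0 := by
      rw [Einv_zero]
      exact Function.iterate_fixed (by simp only [Δ_zero, Einv_zero]) j
    rw [h, mul_zero]
    exact leibNeg_zero n (k - j)

theorem leib_zero (i : ℤ) (k : ℕ) : leib i k (0 : Smooth T 𝕜) = 0 := by
  cases i with
  | ofNat n => exact leibPos_zero n k
  | negSucc n => exact leibNeg_zero (n + 1) k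

end Operators

/-- The formal Laurent series `∑ uᵢ δⁱ` (`uᵢ` smooth, `uᵢ = 0` for all large `i`), given by their
coefficients, with the pointwise left module structure over the smooth functions. -/
def laurent (T : Regular) (𝕜 : Type*) [RCLike 𝕜] : Submodule (Smooth T 𝕜) (ℤ → Smooth T 𝕜) where
  carrier := {u | ∃ m : ℤ, ∀ i, m < i → u i = 0}
  zero_mem' := ⟨0, fun _ _ => rfl⟩
  add_mem' := by
    rintro u v ⟨m, hm⟩ ⟨n, hn⟩
    refine ⟨max m n, fun i hi => ?_⟩
    rw [Pi.add_apply, hm i (lt_of_le_of_lt (le_max_left _ _) hi),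
      hn i (lt_of_le_of_lt (le_max_right _ _) hi), add_zero]
  smul_mem' := by
    rintro c u ⟨m, hm⟩
    exact ⟨m, fun i hi => by rw [Pi.smul_apply, hm i hi, smul_zero]⟩

/-- The algebra of (pseudo-) `δ`-differential operators. -/
abbrev Op (T : Regular) (𝕜 : Type*) [RCLike 𝕜] : Type _ := laurent T 𝕜

section Algebra

variable {T : Regular} {𝕜 : Type*} [RCLike 𝕜]

/-- The monomial `f δⁱ`. -/
def mono (i : ℤ) (f : Smooth T 𝕜) : Op T 𝕜 :=
  ⟨fun j => if j = i then f else 0, i, fun _ hj => if_neg hj.ne'⟩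

/-- The coefficients of a product: `(a δⁱ)(b δʲ) = ∑ₖ a (leib i k b) δⁱ⁺ʲ⁻ᵏ`; the coefficient of
`δᵐ` in the product of two Laurent series is a finite sum. -/
def mulCoeff (P Q : Op T 𝕜) (m : ℤ) : Smooth T 𝕜 :=
  ∑ᶠ p : ℤ × ℤ, if m ≤ p.1 + p.2 then P.1 p.1 * leib p.1 (p.1 + p.2 - m).toNat (Q.1 p.2) else 0

theorem mulCoeff_bdd (P Q : Op T 𝕜) : ∃ m : ℤ, ∀ i, m < i → mulCoeff P Q i = 0 := by
  obtain ⟨a, ha⟩ := P.2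
  obtain ⟨b, hb⟩ := Q.2
  refine ⟨a + b, fun m hm => ?_⟩
  unfold mulCoeff
  refine finsum_eq_zero_of_forall_eq_zero fun p => ?_
  split_ifs with h
  · by_cases h1 : a < p.1
    · rw [ha _ h1, zero_mul]
    · rw [hb p.2 (by omega), leib_zero, mul_zero]
  · rfl

instance : Mul (Op T 𝕜) := ⟨fun P Q => ⟨mulCoeff P Q, mulCoeff_bdd P Q⟩⟩

/-- Powers `Pⁿ` of an operator. -/
def pow (P : Op T 𝕜) : ℕ → Op T 𝕜
  | 0 => mono 0 1
  | n + 1 => pow P n * P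

/-- The commutator `[P, Q] = PQ - QP`. -/
def comm (P Q : Op T 𝕜) : Op T 𝕜 := P * Q - Q * P

/-- The projection `P ↦ P_{≥ k}`. -/
def projGE (k : ℤ) (P : Op T 𝕜) : Op T 𝕜 :=
  ⟨fun i => if k ≤ i then P.1 i else 0, by
    obtain ⟨m, hm⟩ := P.2
    exact ⟨m, fun i hi => by simp [hm i hi]⟩⟩

/-- `R` is an `N`-th root `L^{1/N}` of the operator `L` (of order `≤ N`): `R` has order `≤ 1` and
`Rᴺ = L`. -/
def IsRoot (N : ℕ) (R L : Op T 𝕜) : Prop := (∀ i : ℤ, 1 < i → R.1 i = 0) ∧ pow R N = L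

/-- The action `A[f] = ∑ aᵢ Δⁱ f` of a differential operator `A = ∑_{i ≥ 0} aᵢ δⁱ`. -/
def act (A : Op T 𝕜) (f : Smooth T 𝕜) : Smooth T 𝕜 :=
  ∑ᶠ i : ℕ, A.1 i * Δ^[i] f

/-- The action `A†[f] = ∑ (-Δ E⁻¹)ⁱ (aᵢ f)` of the formal adjoint of a differential operator
`A = ∑_{i ≥ 0} aᵢ δⁱ`. -/
def adjAct (A : Op T 𝕜) (f : Smooth T 𝕜) : Smooth T 𝕜 :=
  ∑ᶠ i : ℕ, (fun g => -Δ (Einv g))^[i] (A.1 i * f)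

/-! ### Finite-field Lax operators and their Lax equations -/

variable {ι : Type*} [Fintype ι] {N : ℕ}

/-- The operator `∑ₛ ψₛ δ⁻¹ φₛ`. -/
def sourceOp (ψ φ : ι → Smooth T 𝕜) : Op T 𝕜 := ∑ s, mono (-1) (ψ s) * mono 0 (φ s)

/-- Case `k = 0`: `L = c δᴺ + u_{N-1} δᴺ⁻¹ + … + u₀ + ∑ₛ ψₛ δ⁻¹ φₛ`. -/
def lax0 (c : Smooth T 𝕜) (u : Fin N → Smooth T 𝕜) (ψ φ : ι → Smooth T 𝕜) : Op T 𝕜 :=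
  mono N c + ∑ i : Fin N, mono (i : ℕ) (u i) + sourceOp ψ φ

/-- Case `k = 1`: `L = u_N δᴺ + … + u₀ + δ⁻¹ w + ∑ₛ ψₛ δ⁻¹ φₛ`, where `w = u₋₁`. -/
def lax1 (u : Fin (N + 1) → Smooth T 𝕜) (w : Smooth T 𝕜) (ψ φ : ι → Smooth T 𝕜) : Op T 𝕜 :=
  ∑ i : Fin (N + 1), mono (i : ℕ) (u i) + mono (-1) 1 * mono 0 w + sourceOp ψ φ

/-- `dL/dt = P` at time `t`, coefficient by coefficient and point by point. -/
def HasTimeDeriv (L : ℝ → Op T 𝕜) (P : Op T 𝕜) (t : ℝ) : Prop :=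
  ∀ (i : ℤ) (x : T.Pt), HasDerivAt (fun τ => ((L τ).1 i).1 x) ((P.1 i).1 x) t

/-- A field `f(t, x)` is differentiable in `t` on `I`. -/
def TimeDiff (I : Set ℝ) (f : ℝ → Smooth T 𝕜) : Prop :=
  ∀ t ∈ I, ∀ x : T.Pt, DifferentiableAt ℝ (fun τ => (f τ).1 x) t

/-- A nonlocal part `∑ⱼ aⱼ δ⁻¹ bⱼ` is recorded, as a formal expression that is `𝕜`-bilinear in
`aⱼ` and `bⱼ`, by its kernel `∑ⱼ aⱼ(x) bⱼ(y)`. This is the kernel of the nonlocal part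
`∑ₛ (A[ψₛ] δ⁻¹ φₛ - ψₛ δ⁻¹ A†[φₛ])` of the commutator `[A, ∑ₛ ψₛ δ⁻¹ φₛ]` for a differential
operator `A`. -/
def commKernel (A : Op T 𝕜) (ψ φ : ι → Smooth T 𝕜) (x y : T.Pt) : 𝕜 :=
  ∑ s, ((act A (ψ s)).1 x * (φ s).1 y - (ψ s).1 x * (adjAct A (φ s)).1 y)

/-- The finite-field Lax equation `dL/dt = [(L^{n/N})_{≥ 0}, L]` for `k = 0` on the time set `I`:
the two sides agree as Laurent series, and their nonlocal parts agree as formal expressions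
`∑ⱼ aⱼ δ⁻¹ bⱼ` (for instance, `dψₛ/dt = A[ψₛ]` and `dφₛ/dt = -A†[φₛ]`). The second condition does
not follow from the first: at scattered points the Laurent expansion of `a δ⁻¹ b` can vanish
although `a b ≠ 0`. -/
structure LaxFlow0 (I : Set ℝ) (n : ℕ) (c : Smooth T 𝕜) (u : Fin N → ℝ → Smooth T 𝕜)
    (ψ φ : ι → ℝ → Smooth T 𝕜) (R : ℝ → Op T 𝕜) : Prop where
  diff_u : ∀ i, TimeDiff I (u i)
  diff_ψ : ∀ s, TimeDiff I (ψ s)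
  diff_φ : ∀ s, TimeDiff I (φ s)
  root : ∀ t ∈ I,
    IsRoot N (R t) (lax0 c (fun i => u i t) (fun s => ψ s t) (fun s => φ s t))
  lax : ∀ t ∈ I,
    HasTimeDeriv (fun τ => lax0 c (fun i => u i τ) (fun s => ψ s τ) (fun s => φ s τ))
      (comm (projGE 0 (pow (R t) n))
        (lax0 c (fun i => u i t) (fun s => ψ s t) (fun s => φ s t))) t
  nonlocal : ∀ t ∈ I, ∀ x y : T.Pt,
    HasDerivAt (fun τ => ∑ s, (ψ s τ).1 x * (φ s τ).1 y)
      (commKernel (projGE 0 (pow (R t) n)) (fun s => ψ s t) (fun s => φ s t) x y) t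

/-- The finite-field Lax equation `dL/dt = [(L^{n/N})_{≥ 1}, L]` for `k = 1` on the time set `I`, in
the same sense. With `A = (L^{n/N})_{≥ 1}` the nonlocal part of `[A, δ⁻¹ w]` is `-δ⁻¹ A†[w]`, since
`A[1] = 0`. -/
structure LaxFlow1 (I : Set ℝ) (n : ℕ) (u : Fin (N + 1) → ℝ → Smooth T 𝕜)
    (w : ℝ → Smooth T 𝕜) (ψ φ : ι → ℝ → Smooth T 𝕜) (R : ℝ → Op T 𝕜) : Prop where
  diff_u : ∀ i, TimeDiff I (u i)
  diff_w : TimeDiff I w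
  diff_ψ : ∀ s, TimeDiff I (ψ s)
  diff_φ : ∀ s, TimeDiff I (φ s)
  root : ∀ t ∈ I,
    IsRoot N (R t) (lax1 (fun i => u i t) (w t) (fun s => ψ s t) (fun s => φ s t))
  lax : ∀ t ∈ I,
    HasTimeDeriv (fun τ => lax1 (fun i => u i τ) (w τ) (fun s => ψ s τ) (fun s => φ s τ))
      (comm (projGE 1 (pow (R t) n))
        (lax1 (fun i => u i t) (w t) (fun s => ψ s t) (fun s => φ s t))) t
  nonlocal : ∀ t ∈ I, ∀ x y : T.Pt,
    HasDerivAt (fun τ => (w τ).1 y + ∑ s, (ψ s τ).1 x * (φ s τ).1 y)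
      (-(adjAct (projGE 1 (pow (R t) n)) (w t)).1 y +
        commKernel (projGE 1 (pow (R t) n)) (fun s => ψ s t) (fun s => φ s t) x y) t

end Algebra

end

end TimeScale

/-!
The statement is pointwise in `x`, and the reason differs with the graininess `μ(x)`.

At a right-dense point only the leading field is left in the sum. The operators form an associative
ring, so `Rⁿ` commutes with `L = Rᴺ`, and `[(Rⁿ)_{≥ k}, L]` equals `-[(Rⁿ)_{< k}, L]`
(`comm_projGE_coeff_of_fixed`). This has order at most `N + k - 1`, and its leading coefficient is
built from values of coefficients shifted by powers of `E`; since `σ(x) = x`, it vanishes at `x`.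

At a right-scattered point `δ = μ⁻¹ (E - 1)`, and any differential operator `A` may stand for
`(Rⁿ)_{≥ k}`. Expanding operators in powers of `E`, with `δ⁻¹ = -(1 + E + E² + ⋯) μ`, the
coefficient of `E⁰` is multiplicative, so it vanishes on `[A, L]`; on `L` it is, up to a power of
`-μ` and the constant term coming from `c_N`, the sum in the statement. To avoid a second
completion, only the part that comes from nonnegative powers of `δ` is treated as a functional
(`symbol`, a character of the differential operators by `symbol_mul`), and the contribution of the
nonlocal part is the diagonal value of its kernel, multiplied by `-μ`. The link between the two is
`symbol_comm_source`, which follows from dividing by `δ` with remainder: `A ψ = D δ + A[ψ]` and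
`φ A = δ D' + A†[φ]`. This is where the equality of nonlocal parts as formal expressions enters.
For `k = 1` the term `δ⁻¹ u₋₁` is one more source, with `ψ = 1` and `A[1] = 0`.

Associativity is proved by extending identities from monomials: an additive map that raises orders
by a bounded amount is determined by its values on monomials (`eq_of_forall_mono`), and left
multiplication by `δ` is injective (`delta_mul_injective`), which passes from `δ` to `δ⁻¹`.
-/

namespace TimeScale

/-! ### The shift and the delta derivative -/

section Shift

variable {T : Regular} {𝕜 : Type*} [RCLike 𝕜]

theorem E_add (f g : Smooth T 𝕜) : E (f + g) = E f + E g := rfl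

theorem E_neg (f : Smooth T 𝕜) : E (-f) = -E f := rfl

theorem E_mul (f g : Smooth T 𝕜) : E (f * g) = E f * E g := rfl

theorem E_one : E (1 : Smooth T 𝕜) = 1 := rfl

theorem Einv_add (f g : Smooth T 𝕜) : Einv (f + g) = Einv f + Einv g := rfl

theorem E_Einv (f : Smooth T 𝕜) : E (Einv f) = f := by
  refine Subtype.ext (funext fun x => ?_)
  simp [E, Einv]

theorem Einv_E (f : Smooth T 𝕜) : Einv (E f) = f := by
  refine Subtype.ext (funext fun x => ?_)
  simp [E, Einv]

theorem deltaDiff (f : Smooth T 𝕜) : DeltaDiff f.1 := (f.2 1).1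

theorem Δ_add (f g : Smooth T 𝕜) : Δ (f + g) = Δ f + Δ g :=
  Subtype.ext (rawDelta_add (deltaDiff f) (deltaDiff g))

theorem Δ_mul (f g : Smooth T 𝕜) : Δ (f * g) = Δ f * g + E f * Δ g :=
  Subtype.ext (rawDelta_mul (deltaDiff f) (deltaDiff g))

theorem Δ_one : Δ (1 : Smooth T 𝕜) = 0 := Subtype.ext (rawDelta_const 1)

theorem Δ_neg (f : Smooth T 𝕜) : Δ (-f) = -Δ f :=
  eq_neg_of_add_eq_zero_left (by rw [← Δ_add, neg_add_cancel, Δ_zero])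

theorem Einv_neg (f : Smooth T 𝕜) : Einv (-f) = -Einv f := rfl

theorem E_sum {κ : Type*} (s : Finset κ) (f : κ → Smooth T 𝕜) :
    E (∑ j ∈ s, f j) = ∑ j ∈ s, E (f j) := map_sum (AddMonoidHom.mk' E E_add) f s

theorem Δ_sum {κ : Type*} (s : Finset κ) (f : κ → Smooth T 𝕜) :
    Δ (∑ j ∈ s, f j) = ∑ j ∈ s, Δ (f j) := by
  classical
  induction s using Finset.induction_on with
  | empty => rw [Finset.sum_empty, Finset.sum_empty, Δ_zero]
  | insert j s hj ih => rw [Finset.sum_insert hj, Finset.sum_insert hj, Δ_add, ih]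

/-! ### The commutation coefficients of `δⁱ` -/

/-- The coefficient of `δ⁻¹⁻ʲ` in `δ⁻¹ f`. -/
noncomputable def invCoeff (j : ℕ) (f : Smooth T 𝕜) : Smooth T 𝕜 :=
  (-1) ^ j * (fun g => Einv (Δ g))^[j] (Einv f)

theorem invCoeff_zero (f : Smooth T 𝕜) : invCoeff 0 f = Einv f := by
  simp [invCoeff]

theorem invCoeff_succ (j : ℕ) (f : Smooth T 𝕜) :
    invCoeff (j + 1) f = -Einv (Δ (invCoeff j f)) := by
  unfold invCoeff
  rw [Function.iterate_succ_apply', pow_succ]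
  have h1 : ∀ g : Smooth T 𝕜, -1 * g = -g := fun g => neg_one_mul g
  rcases neg_one_pow_eq_or (Smooth T 𝕜) j with h | h <;> rw [h]
  · rw [one_mul, one_mul]
    exact h1 _
  · rw [h1, h1, neg_neg, Δ_neg, Einv_neg, neg_neg]
    exact one_mul _

theorem invCoeff_add (j : ℕ) (f g : Smooth T 𝕜) :
    invCoeff j (f + g) = invCoeff j f + invCoeff j g := by
  induction j with
  | zero => simp [invCoeff_zero, Einv_add]
  | succ j ih => rw [invCoeff_succ, invCoeff_succ, invCoeff_succ, ih, Δ_add, Einv_add, neg_add]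

theorem leibPos_add (n k : ℕ) (f g : Smooth T 𝕜) :
    leibPos n k (f + g) = leibPos n k f + leibPos n k g := by
  induction n generalizing k with
  | zero => cases k <;> simp [leibPos]
  | succ n ih =>
    cases k with
    | zero => rw [leibPos, leibPos, leibPos, ih, E_add]
    | succ k =>
      rw [leibPos, leibPos, leibPos, ih, ih, E_add, Δ_add]
      abel

theorem leibNeg_succ (n k : ℕ) (f : Smooth T 𝕜) :
    leibNeg (n + 1) k f = ∑ j ∈ Finset.range (k + 1), leibNeg n (k - j) (invCoeff j f) := rfl

theorem leibNeg_add (n k : ℕ) (f g : Smooth T 𝕜) :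
    leibNeg n k (f + g) = leibNeg n k f + leibNeg n k g := by
  induction n generalizing k f g with
  | zero => cases k <;> simp [leibNeg]
  | succ n ih =>
    simp only [leibNeg_succ, invCoeff_add, ih, Finset.sum_add_distrib]

theorem leib_add (i : ℤ) (k : ℕ) (f g : Smooth T 𝕜) :
    leib i k (f + g) = leib i k f + leib i k g := by
  cases i with
  | ofNat n => exact leibPos_add n k f g
  | negSucc n => exact leibNeg_add (n + 1) k f g

theorem leibNeg_one (k : ℕ) (f : Smooth T 𝕜) : leibNeg 1 k f = invCoeff k f := by
  rw [leibNeg_succ, Finset.sum_range_succ, Finset.sum_eq_zero, zero_add, Nat.sub_self]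
  · rfl
  · intro j hj
    obtain ⟨l, hl⟩ : ∃ l, k - j = l + 1 := ⟨k - j - 1, by have := Finset.mem_range.1 hj; omega⟩
    rw [hl]
    rfl

/-- `δ δ⁻ⁿ⁻¹ = δ⁻ⁿ`, read off at the leading coefficient. -/
theorem E_leibNeg_zero (n : ℕ) (f : Smooth T 𝕜) :
    E (leibNeg (n + 1) 0 f) = leibNeg n 0 f := by
  induction n generalizing f with
  | zero => rw [leibNeg_one, invCoeff_zero, E_Einv]; rfl
  | succ n ih => rw [leibNeg_succ, leibNeg_succ]; simp [ih]

/-- `δ δ⁻ⁿ⁻¹ = δ⁻ⁿ`, read off at the lower coefficients. -/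
theorem E_leibNeg_succ (n k : ℕ) (f : Smooth T 𝕜) :
    E (leibNeg (n + 1) (k + 1) f) + Δ (leibNeg (n + 1) k f) = leibNeg n (k + 1) f := by
  induction n generalizing k f with
  | zero =>
    rw [leibNeg_one, leibNeg_one, invCoeff_succ, E_neg, E_Einv, neg_add_cancel]
    rfl
  | succ n ih =>
    rw [leibNeg_succ, leibNeg_succ (n + 1) k, leibNeg_succ n, Finset.sum_range_succ,
      Finset.sum_range_succ _ (k + 1), E_add, E_sum, Δ_sum, Nat.sub_self, E_leibNeg_zero,
      add_right_comm, ← Finset.sum_add_distrib]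
    congr 1
    refine Finset.sum_congr rfl fun j hj => ?_
    have h : k + 1 - j = (k - j) + 1 := by have := Finset.mem_range.1 hj; omega
    rw [h, ih]

theorem leib_succ_zero (i : ℤ) (f : Smooth T 𝕜) : leib (i + 1) 0 f = E (leib i 0 f) := by
  cases i with
  | ofNat n => rfl
  | negSucc n =>
    cases n with
    | zero => exact (E_leibNeg_zero 0 f).symm
    | succ n => exact (E_leibNeg_zero (n + 1) f).symm

theorem leib_succ_succ (i : ℤ) (k : ℕ) (f : Smooth T 𝕜) :
    leib (i + 1) (k + 1) f = E (leib i (k + 1) f) + Δ (leib i k f) := by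
  cases i with
  | ofNat n => rfl
  | negSucc n =>
    cases n with
    | zero => exact (E_leibNeg_succ 0 k f).symm
    | succ n => exact (E_leibNeg_succ (n + 1) k f).symm

/-- The coefficient of `δⁱ⁻ᵏ` in `δⁱ f`, for an integer `k`; it vanishes for `k < 0`. -/
noncomputable def leibInt (i k : ℤ) (f : Smooth T 𝕜) : Smooth T 𝕜 :=
  if 0 ≤ k then leib i k.toNat f else 0

theorem leibInt_of_neg {i k : ℤ} (hk : k < 0) (f : Smooth T 𝕜) : leibInt i k f = 0 :=
  if_neg (not_le.2 hk)

theorem leibInt_zero (i k : ℤ) : leibInt i k (0 : Smooth T 𝕜) = 0 := by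
  unfold leibInt
  rw [leib_zero, ite_self]

theorem leibInt_add (i k : ℤ) (f g : Smooth T 𝕜) :
    leibInt i k (f + g) = leibInt i k f + leibInt i k g := by
  unfold leibInt
  split_ifs
  · exact leib_add i _ f g
  · rw [add_zero]

/-- The identity `δⁱ⁺¹ = δ δⁱ` in terms of coefficients. -/
theorem leibInt_succ (i k : ℤ) (f : Smooth T 𝕜) :
    leibInt (i + 1) k f = E (leibInt i k f) + Δ (leibInt i (k - 1) f) := by
  rcases lt_trichotomy k 0 with hk | rfl | hk
  · rw [leibInt_of_neg hk, leibInt_of_neg hk, leibInt_of_neg (by omega), E_zero, Δ_zero, add_zero]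
  · rw [leibInt_of_neg (k := 0 - 1) (by omega), Δ_zero, add_zero]
    exact leib_succ_zero i f
  · obtain ⟨n, rfl⟩ : ∃ n : ℕ, k = n + 1 := ⟨(k - 1).toNat, by omega⟩
    have h : ((n : ℤ) + 1 - 1) = n := by omega
    rw [h]
    unfold leibInt
    rw [if_pos (by omega), if_pos (by omega), if_pos (by omega)]
    exact leib_succ_succ i n f

theorem leibInt_zero_left (k : ℤ) (f : Smooth T 𝕜) : leibInt 0 k f = if k = 0 then f else 0 := by
  rcases lt_trichotomy k 0 with hk | rfl | hk
  · rw [leibInt_of_neg hk, if_neg hk.ne]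
  · rfl
  · obtain ⟨n, rfl⟩ : ∃ n : ℕ, k = n + 1 := ⟨(k - 1).toNat, by omega⟩
    rw [if_neg hk.ne', leibInt, if_pos hk.le]
    rfl

/-- The leading coefficient of `δⁱ f` is a shift of `f`, hence agrees with `f` at the fixed points
of the jump operator. -/
theorem leibInt_apply_of_fixed {x : T.Pt} (hx : σ T x = x) (i : ℤ) (f : Smooth T 𝕜) :
    (leibInt i 0 f).1 x = f.1 x := by
  have hE : ∀ g : Smooth T 𝕜, (E g).1 x = g.1 x := fun g => congrArg g.1 hx
  have h : ∀ j : ℤ, (leibInt (j + 1) 0 f).1 x = (leibInt j 0 f).1 x := fun j => by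
    rw [leibInt_succ, leibInt_of_neg (k := 0 - 1) (by omega), Δ_zero, add_zero, hE]
  induction i with
  | zero => rw [leibInt_zero_left, if_pos rfl]
  | succ i ih => rw [h, ih]
  | pred i ih => rw [← ih, ← h, sub_add_cancel]

end Shift

/-! ### Multiplication of Laurent series -/

section Product

variable {T : Regular} {𝕜 : Type*} [RCLike 𝕜]

theorem Op.ext {P Q : Op T 𝕜} (h : ∀ m, P.1 m = Q.1 m) : P = Q := Subtype.ext (funext h)

theorem coe_sum {κ : Type*} (s : Finset κ) (P : κ → Op T 𝕜) (m : ℤ) :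
    (∑ j ∈ s, P j).1 m = ∑ j ∈ s, (P j).1 m := by
  rw [AddSubmonoidClass.coe_finsetSum, Finset.sum_apply]

/-- `P` has order at most `a`. -/
def OrdLE (a : ℤ) (P : Op T 𝕜) : Prop := ∀ i, a < i → P.1 i = 0

theorem exists_ordLE (P : Op T 𝕜) : ∃ a, OrdLE a P := P.2

theorem OrdLE.mono {a b : ℤ} {P : Op T 𝕜} (h : OrdLE a P) (hab : a ≤ b) : OrdLE b P :=
  fun i hi => h i (hab.trans_lt hi)

theorem OrdLE.add {a : ℤ} {P Q : Op T 𝕜} (hP : OrdLE a P) (hQ : OrdLE a Q) : OrdLE a (P + Q) :=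
  fun i hi => by
    change P.1 i + Q.1 i = 0
    rw [hP i hi, hQ i hi, add_zero]

theorem OrdLE.sub {a : ℤ} {P Q : Op T 𝕜} (hP : OrdLE a P) (hQ : OrdLE a Q) : OrdLE a (P - Q) :=
  fun i hi => by
    change P.1 i - Q.1 i = 0
    rw [hP i hi, hQ i hi, sub_zero]

theorem OrdLE.sum {a : ℤ} {κ : Type*} {s : Finset κ} {P : κ → Op T 𝕜}
    (hP : ∀ j ∈ s, OrdLE a (P j)) : OrdLE a (∑ j ∈ s, P j) :=
  fun i hi => by
    rw [coe_sum]
    exact Finset.sum_eq_zero fun j hj => hP j hj i hi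

theorem mono_coeff (i : ℤ) (f : Smooth T 𝕜) (m : ℤ) :
    (mono i f).1 m = if m = i then f else 0 := rfl

theorem ordLE_mono (i : ℤ) (f : Smooth T 𝕜) : OrdLE i (mono i f) := fun _ hj => if_neg hj.ne'

theorem mono_add (i : ℤ) (f g : Smooth T 𝕜) : mono i (f + g) = mono i f + mono i g :=
  Op.ext fun m => by
    change (mono i (f + g)).1 m = (mono i f).1 m + (mono i g).1 m
    simp only [mono_coeff]
    split_ifs <;> simp

theorem mono_neg (i : ℤ) (f : Smooth T 𝕜) : mono i (-f) = -mono i f :=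
  Op.ext fun m => by
    change (mono i (-f)).1 m = -(mono i f).1 m
    simp only [mono_coeff]
    split_ifs <;> simp

theorem mul_coeff (P Q : Op T 𝕜) (m : ℤ) :
    (P * Q).1 m = ∑ᶠ p : ℤ × ℤ, P.1 p.1 * leibInt p.1 (p.1 + p.2 - m) (Q.1 p.2) := by
  change mulCoeff P Q m = _
  unfold mulCoeff
  refine finsum_congr fun p => ?_
  unfold leibInt
  by_cases h : m ≤ p.1 + p.2
  · rw [if_pos h, if_pos (by omega)]
  · rw [if_neg h, if_neg (by omega), mul_zero]

theorem mul_coeff_eq_sum {P Q : Op T 𝕜} {a b p q m : ℤ} (hP : OrdLE a P) (hQ : OrdLE b Q)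
    (hp : p ≤ m - b) (hq : q ≤ m - a) :
    (P * Q).1 m = ∑ i ∈ Finset.Icc p a, ∑ j ∈ Finset.Icc q b,
      P.1 i * leibInt i (i + j - m) (Q.1 j) := by
  rw [mul_coeff, ← Finset.sum_product']
  refine finsum_eq_sum_of_support_subset _ fun r hr => ?_
  rw [Function.mem_support] at hr
  by_contra h
  apply hr
  simp only [Finset.coe_product, Finset.coe_Icc, Set.mem_prod, Set.mem_Icc] at h
  by_cases h1 : a < r.1
  · simp only [hP _ h1, zero_mul]
  by_cases h2 : b < r.2
  · simp only [hQ _ h2, leibInt_zero, mul_zero]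
  · rw [leibInt_of_neg (i := r.1) (k := r.1 + r.2 - m) (by omega), mul_zero]

theorem OrdLE.mul {a b : ℤ} {P Q : Op T 𝕜} (hP : OrdLE a P) (hQ : OrdLE b Q) :
    OrdLE (a + b) (P * Q) := fun m hm => by
  rw [mul_coeff_eq_sum hP hQ le_rfl le_rfl, Finset.Icc_eq_empty (by omega), Finset.sum_empty]

theorem mul_coeff_top {a b : ℤ} {P Q : Op T 𝕜} (hP : OrdLE a P) (hQ : OrdLE b Q) :
    (P * Q).1 (a + b) = P.1 a * leibInt a 0 (Q.1 b) := by
  rw [mul_coeff_eq_sum (p := a) (q := b) hP hQ (by omega) (by omega)]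
  simp

theorem op_add_mul (P P' Q : Op T 𝕜) : (P + P') * Q = P * Q + P' * Q := by
  obtain ⟨a, ha⟩ := exists_ordLE P
  obtain ⟨a', ha'⟩ := exists_ordLE P'
  obtain ⟨b, hb⟩ := exists_ordLE Q
  have h1 := ha.mono (le_max_left a a')
  have h2 := ha'.mono (le_max_right a a')
  refine Op.ext fun m => ?_
  change ((P + P') * Q).1 m = (P * Q).1 m + (P' * Q).1 m
  rw [mul_coeff_eq_sum h1 hb le_rfl le_rfl, mul_coeff_eq_sum h2 hb le_rfl le_rfl,
    mul_coeff_eq_sum (h1.add h2) hb le_rfl le_rfl]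
  simp only [← Finset.sum_add_distrib, ← add_mul]
  rfl

theorem op_mul_add (P Q Q' : Op T 𝕜) : P * (Q + Q') = P * Q + P * Q' := by
  obtain ⟨a, ha⟩ := exists_ordLE P
  obtain ⟨b, hb⟩ := exists_ordLE Q
  obtain ⟨b', hb'⟩ := exists_ordLE Q'
  have h1 := hb.mono (le_max_left b b')
  have h2 := hb'.mono (le_max_right b b')
  refine Op.ext fun m => ?_
  change (P * (Q + Q')).1 m = (P * Q).1 m + (P * Q').1 m
  rw [mul_coeff_eq_sum ha h1 le_rfl le_rfl, mul_coeff_eq_sum ha h2 le_rfl le_rfl,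
    mul_coeff_eq_sum ha (h1.add h2) le_rfl le_rfl]
  simp only [← Finset.sum_add_distrib, ← mul_add, ← leibInt_add]
  rfl

theorem mono_mul_coeff {i b q m : ℤ} (f : Smooth T 𝕜) {Q : Op T 𝕜} (hQ : OrdLE b Q)
    (hq : q ≤ m - i) :
    (mono i f * Q).1 m = f * ∑ j ∈ Finset.Icc q b, leibInt i (i + j - m) (Q.1 j) := by
  rw [mul_coeff_eq_sum (p := min i (m - b)) (ordLE_mono i f) hQ (min_le_right _ _) hq,
    Finset.sum_eq_single_of_mem i (by simp), Finset.mul_sum]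
  · simp [mono_coeff]
  · intro j _ hj
    simp [mono_coeff, hj]

theorem mono_zero_mul_coeff (f : Smooth T 𝕜) (Q : Op T 𝕜) (m : ℤ) :
    (mono 0 f * Q).1 m = f * Q.1 m := by
  obtain ⟨b, hb⟩ := exists_ordLE Q
  have hb' := hb.mono (le_max_left b m)
  rw [mono_mul_coeff (q := m) f hb' (by omega), Finset.sum_eq_single_of_mem m (by simp)]
  · simp [leibInt_zero_left]
  · intro j _ hj
    rw [leibInt_zero_left, if_neg (by omega)]

theorem mono_mul (i : ℤ) (f : Smooth T 𝕜) (Q : Op T 𝕜) :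
    mono i f * Q = mono 0 f * (mono i 1 * Q) := by
  obtain ⟨b, hb⟩ := exists_ordLE Q
  refine Op.ext fun m => ?_
  rw [mono_zero_mul_coeff, mono_mul_coeff f hb le_rfl, mono_mul_coeff 1 hb le_rfl, one_mul]

/-- The rule `δ f = Δ f + E(f) δ`, coefficient by coefficient. -/
theorem delta_mul_coeff (Q : Op T 𝕜) (m : ℤ) :
    (mono 1 1 * Q).1 m = E (Q.1 (m - 1)) + Δ (Q.1 m) := by
  obtain ⟨b, hb⟩ := exists_ordLE Q
  have hb' := hb.mono (le_max_left b m)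
  have hm := le_max_right b m
  have h1 : ∀ (k : ℤ) (f : Smooth T 𝕜),
      leibInt 1 k f = (if k = 0 then E f else 0) + if k = 1 then Δ f else 0 := fun k f => by
    have := leibInt_succ 0 k f
    rw [zero_add] at this
    simp only [this, leibInt_zero_left, sub_eq_zero]
    split_ifs <;> simp [E_zero, Δ_zero]
  rw [mono_mul_coeff (q := m - 1) 1 hb' le_rfl, one_mul]
  simp only [h1, Finset.sum_add_distrib]
  congr 1
  · rw [Finset.sum_eq_single_of_mem (m - 1) (by simp), if_pos (by omega)]
    intro j _ hj
    rw [if_neg (by omega)]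
  · rw [Finset.sum_eq_single_of_mem m (by simp), if_pos (by omega)]
    intro j _ hj
    rw [if_neg (by omega)]

theorem delta_mul_mono_mul (i : ℤ) (Q : Op T 𝕜) :
    mono 1 1 * (mono i 1 * Q) = mono (i + 1) 1 * Q := by
  obtain ⟨b, hb⟩ := exists_ordLE Q
  refine Op.ext fun m => ?_
  rw [delta_mul_coeff, mono_mul_coeff (q := m - i - 1) 1 hb (by omega),
    mono_mul_coeff (q := m - i - 1) 1 hb (by omega),
    mono_mul_coeff (q := m - i - 1) 1 hb (by omega), one_mul, one_mul, one_mul, E_sum, Δ_sum,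
    ← Finset.sum_add_distrib]
  refine Finset.sum_congr rfl fun j _ => ?_
  rw [leibInt_succ, show i + j - (m - 1) = i + 1 + j - m by ring,
    show i + 1 + j - m - 1 = i + j - m by ring]

theorem ordLE_unbounded {Z : Op T 𝕜} (h : ∀ a, OrdLE a Z) : Z = 0 :=
  Op.ext fun m => h (m - 1) m (by omega)

/-- Left multiplication by `δ` is injective, because it shifts the leading coefficient by the
automorphism `E`. -/
theorem delta_mul_injective {X Y : Op T 𝕜} (h : mono 1 1 * X = mono 1 1 * Y) : X = Y := by
  obtain ⟨b, hb⟩ := exists_ordLE X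
  obtain ⟨b', hb'⟩ := exists_ordLE Y
  have hE : ∀ {f g : Smooth T 𝕜}, E f = E g → f = g := fun {f g} h => by
    rw [← Einv_E f, h, Einv_E]
  have key : ∀ n : ℕ, ∀ i, max b b' - n < i → X.1 i = Y.1 i := by
    intro n
    induction n with
    | zero =>
      intro i hi
      rw [hb i (by omega), hb' i (by omega)]
    | succ n ih =>
      intro i hi
      by_cases hi' : max b b' - n < i
      · exact ih i hi'
      have h2 := congrArg (fun P : Op T 𝕜 => P.1 (i + 1)) h
      simp only [delta_mul_coeff, ih (i + 1) (by push_cast at hi; omega), add_sub_cancel_right,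
        add_left_inj] at h2
      exact hE h2
  exact Op.ext fun m => key (max b b' - m + 1).toNat m (by omega)

/-- An additive map that raises orders by a bounded amount is determined by its values on
monomials: it is continuous for the topology given by the order filtration, in which the finite
sums of monomials are dense. -/
theorem eq_of_forall_mono {F G : Op T 𝕜 → Op T 𝕜} {d : ℤ}
    (hF : ∀ P Q, F (P + Q) = F P + F Q) (hG : ∀ P Q, G (P + Q) = G P + G Q)
    (hFd : ∀ a P, OrdLE a P → OrdLE (a + d) (F P)) (hGd : ∀ a P, OrdLE a P → OrdLE (a + d) (G P))
    (h : ∀ i f, F (mono i f) = G (mono i f)) (P : Op T 𝕜) : F P = G P := by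
  obtain ⟨b, hb⟩ := exists_ordLE P
  have key : ∀ n : ℕ, ∀ P, OrdLE b P → ∃ P', OrdLE (b - n) P' ∧ F P - G P = F P' - G P' := by
    intro n
    induction n with
    | zero => exact fun P hP => ⟨P, by simpa using hP, rfl⟩
    | succ n ih =>
      intro P hP
      obtain ⟨P', h1, h2⟩ := ih P hP
      refine ⟨P' - mono (b - n) (P'.1 (b - n)), fun i hi => ?_, ?_⟩
      · change P'.1 i - (mono (b - n) (P'.1 (b - n))).1 i = 0
        rw [mono_coeff]
        split_ifs with hi'
        · rw [hi', sub_self]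
        · rw [h1 i (by push_cast at hi; omega), sub_zero]
      · rw [h2]
        conv_lhs => rw [← sub_add_cancel P' (mono (b - n) (P'.1 (b - n)))]
        rw [hF, hG, h]
        abel
  rw [← sub_eq_zero]
  refine ordLE_unbounded fun a => ?_
  obtain ⟨P', h1, h2⟩ := key (b + d - a).toNat P hb
  rw [h2]
  exact ((hFd _ _ h1).sub (hGd _ _ h1)).mono (by omega)

theorem mono_zero_mul_assoc (f : Smooth T 𝕜) (P Q : Op T 𝕜) :
    mono 0 f * (P * Q) = (mono 0 f * P) * Q := by
  obtain ⟨b, hb⟩ := exists_ordLE Q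
  refine eq_of_forall_mono (F := fun P => mono 0 f * (P * Q)) (G := fun P => (mono 0 f * P) * Q)
    (d := b) (fun P P' => ?_) (fun P P' => ?_) (fun a P hP => ?_) (fun a P hP => ?_)
    (fun i g => ?_) P
  · simp only [op_add_mul, op_mul_add]
  · simp only [op_add_mul, op_mul_add]
  · exact ((ordLE_mono 0 f).mul (hP.mul hb)).mono (by omega)
  · exact (((ordLE_mono 0 f).mul hP).mul hb).mono (by omega)
  · have h : mono 0 f * mono i g = mono i (f * g) := Op.ext fun m => by
      rw [mono_zero_mul_coeff, mono_coeff, mono_coeff, mul_ite, mul_zero]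
    simp only [h]
    rw [mono_mul i g, mono_mul i (f * g)]
    refine Op.ext fun m => ?_
    simp only [mono_zero_mul_coeff, mul_assoc]

theorem delta_mul_mono (i : ℤ) (f : Smooth T 𝕜) :
    mono 1 1 * mono i f = mono (i + 1) (E f) + mono i (Δ f) := Op.ext fun m => by
  rw [delta_mul_coeff]
  change _ = (mono (i + 1) (E f)).1 m + (mono i (Δ f)).1 m
  simp only [mono_coeff, sub_eq_iff_eq_add]
  split_ifs <;> simp [E_zero, Δ_zero]

theorem delta_mul_assoc (P Q : Op T 𝕜) : mono 1 1 * (P * Q) = (mono 1 1 * P) * Q := by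
  obtain ⟨b, hb⟩ := exists_ordLE Q
  refine eq_of_forall_mono (F := fun P => mono 1 1 * (P * Q)) (G := fun P => (mono 1 1 * P) * Q)
    (d := 1 + b) (fun P P' => ?_) (fun P P' => ?_) (fun a P hP => ?_) (fun a P hP => ?_)
    (fun i f => ?_) P
  · simp only [op_add_mul, op_mul_add]
  · simp only [op_add_mul, op_mul_add]
  · exact ((ordLE_mono 1 1).mul (hP.mul hb)).mono (by omega)
  · exact (((ordLE_mono 1 1).mul hP).mul hb).mono (by omega)
  · simp only [delta_mul_mono, op_add_mul]
    rw [mono_mul i f, mono_mul (i + 1) (E f), mono_mul i (Δ f), ← delta_mul_mono_mul]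
    refine Op.ext fun m => ?_
    change _ = (mono 0 (E f) * _).1 m + (mono 0 (Δ f) * _).1 m
    simp only [delta_mul_coeff, mono_zero_mul_coeff, E_mul, Δ_mul]
    ring

theorem mono_one_mul_assoc (i : ℤ) (P Q : Op T 𝕜) :
    mono i 1 * (P * Q) = (mono i 1 * P) * Q := by
  induction i with
  | zero => exact mono_zero_mul_assoc 1 P Q
  | succ i ih => rw [← delta_mul_mono_mul, ih, delta_mul_assoc, delta_mul_mono_mul]
  | pred i ih =>
    refine delta_mul_injective ?_
    rw [delta_mul_mono_mul, delta_mul_assoc, delta_mul_mono_mul, sub_add_cancel, ih]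

theorem op_mul_assoc (P Q R : Op T 𝕜) : P * Q * R = P * (Q * R) := by
  obtain ⟨b, hb⟩ := exists_ordLE Q
  obtain ⟨c, hc⟩ := exists_ordLE R
  refine eq_of_forall_mono (F := fun P => P * Q * R) (G := fun P => P * (Q * R))
    (d := b + c) (fun P P' => ?_) (fun P P' => ?_) (fun a P hP => ?_) (fun a P hP => ?_)
    (fun i f => ?_) P
  · simp only [op_add_mul]
  · simp only [op_add_mul]
  · exact ((hP.mul hb).mul hc).mono (by omega)
  · exact (hP.mul (hb.mul hc)).mono (by omega)
  · rw [mono_mul i f Q, mono_mul i f (Q * R), mono_one_mul_assoc]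
    exact (mono_zero_mul_assoc f _ R).symm

theorem op_one_mul (Q : Op T 𝕜) : mono 0 1 * Q = Q := Op.ext fun m => by
  rw [mono_zero_mul_coeff, one_mul]

theorem mono_one_mul_one (i : ℤ) : mono i 1 * mono 0 1 = (mono i 1 : Op T 𝕜) := by
  have h : ∀ j : ℤ, mono 1 1 * mono j 1 = (mono (j + 1) 1 : Op T 𝕜) := fun j => by
    rw [delta_mul_mono, E_one, Δ_one]
    refine Op.ext fun m => ?_
    change (mono (j + 1) 1).1 m + (mono j 0).1 m = _
    simp [mono_coeff]
  induction i with
  | zero => exact op_one_mul _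
  | succ i ih => rw [← delta_mul_mono_mul, ih, h]
  | pred i ih =>
    refine delta_mul_injective ?_
    rw [delta_mul_mono_mul, h, sub_add_cancel, ih]

theorem op_mul_one (P : Op T 𝕜) : P * mono 0 1 = P := by
  refine eq_of_forall_mono (F := fun P => P * mono 0 1) (G := fun P => P)
    (d := 0) (fun P P' => op_add_mul _ _ _) (fun P P' => rfl)
    (fun a P hP => hP.mul (ordLE_mono 0 1)) (fun a P hP => hP.mono (by omega)) (fun i f => ?_) P
  rw [mono_mul, mono_one_mul_one]
  refine Op.ext fun m => ?_
  simp [mono_zero_mul_coeff, mono_coeff]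

/-- The formal Laurent series of `δ`-differential operators form a ring. -/
noncomputable instance : Ring (Op T 𝕜) :=
  { (inferInstance : AddCommGroup (Op T 𝕜)), (inferInstance : Mul (Op T 𝕜)) with
    one := mono 0 1
    left_distrib := op_mul_add
    right_distrib := op_add_mul
    zero_mul := fun P => by
      have h := op_add_mul 0 0 P
      rwa [add_zero, left_eq_add] at h
    mul_zero := fun P => by
      have h := op_mul_add P 0 0
      rwa [add_zero, left_eq_add] at h
    mul_assoc := op_mul_assoc
    one_mul := op_one_mul
    mul_one := op_mul_one }

theorem one_eq_mono : (1 : Op T 𝕜) = mono 0 1 := rfl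

theorem pow_eq (P : Op T 𝕜) (n : ℕ) : pow P n = P ^ n := by
  induction n with
  | zero => rw [pow_zero]; rfl
  | succ n ih => rw [pow_succ, ← ih]; rfl

end Product

/-! ### Commutators at right-dense points -/

section Dense

variable {T : Regular} {𝕜 : Type*} [RCLike 𝕜]

/-- At a fixed point of the jump operator the leading coefficients of two operators multiply like
scalars, so that the leading coefficient of a commutator vanishes. -/
theorem comm_coeff_top_of_fixed {x : T.Pt} (hx : σ T x = x) {a b : ℤ} {P Q : Op T 𝕜}
    (hP : OrdLE a P) (hQ : OrdLE b Q) : ((comm P Q).1 (a + b)).1 x = 0 := by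
  change ((P * Q).1 (a + b) - (Q * P).1 (a + b)).1 x = 0
  rw [mul_coeff_top hP hQ, add_comm a b, mul_coeff_top hQ hP]
  change (P.1 a).1 x * (leibInt a 0 (Q.1 b)).1 x - (Q.1 b).1 x * (leibInt b 0 (P.1 a)).1 x = 0
  rw [leibInt_apply_of_fixed hx, leibInt_apply_of_fixed hx, mul_comm, sub_self]

/-- Since `Rⁿ` commutes with `L = Rᴺ`, the commutator of `L` with `(Rⁿ)_{≥ k}` is that with
`-(Rⁿ)_{< k}`, which has order at most `N + k - 1`; its leading coefficient vanishes at the fixed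
points of the jump operator. -/
theorem comm_projGE_coeff_of_fixed {x : T.Pt} (hx : σ T x = x) {N : ℕ} {R L : Op T 𝕜}
    (hR : IsRoot N R L) (hL : OrdLE N L) (n : ℕ) (k : ℤ) :
    ((comm (projGE k (pow R n)) L).1 (k - 1 + N)).1 x = 0 := by
  have h : comm (pow R n) L = 0 := by
    rw [← hR.2, pow_eq, pow_eq, comm, sub_eq_zero, ← pow_add, ← pow_add, add_comm]
  have h1 : comm (projGE k (pow R n)) L = comm (projGE k (pow R n) - pow R n) L := by
    rw [← add_zero (comm (projGE k (pow R n) - pow R n) L), ← h]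
    unfold comm
    noncomm_ring
  rw [h1]
  refine comm_coeff_top_of_fixed hx (fun i hi => ?_) hL
  change (if k ≤ i then (pow R n).1 i else 0) - (pow R n).1 i = 0
  rw [if_pos (by omega), sub_self]

end Dense

/-! ### Differential operators -/

section Differential

variable {T : Regular} {𝕜 : Type*} [RCLike 𝕜]

/-- `P` is a differential operator: it has no negative powers of `δ`. -/
def IsDiff (P : Op T 𝕜) : Prop := ∀ i < 0, P.1 i = 0

theorem isDiff_mono (n : ℕ) (f : Smooth T 𝕜) : IsDiff (mono (n : ℤ) f) := fun i hi => by
  rw [mono_coeff, if_neg (by omega)]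

theorem isDiff_mono_zero (f : Smooth T 𝕜) : IsDiff (mono 0 f) := isDiff_mono 0 f

theorem isDiff_delta : IsDiff (mono 1 1 : Op T 𝕜) := isDiff_mono 1 1

theorem IsDiff.add {P Q : Op T 𝕜} (hP : IsDiff P) (hQ : IsDiff Q) : IsDiff (P + Q) :=
  fun i hi => by
    change P.1 i + Q.1 i = 0
    rw [hP i hi, hQ i hi, add_zero]

theorem IsDiff.sum {κ : Type*} {s : Finset κ} {P : κ → Op T 𝕜} (hP : ∀ j ∈ s, IsDiff (P j)) :
    IsDiff (∑ j ∈ s, P j) := fun i hi => by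
  rw [coe_sum]
  exact Finset.sum_eq_zero fun j hj => hP j hj i hi

theorem IsDiff.mono_zero_mul {Q : Op T 𝕜} (hQ : IsDiff Q) (f : Smooth T 𝕜) :
    IsDiff (mono 0 f * Q) := fun i hi => by
  rw [mono_zero_mul_coeff, hQ i hi, mul_zero]

theorem IsDiff.delta_mul {Q : Op T 𝕜} (hQ : IsDiff Q) : IsDiff (mono 1 1 * Q) := fun i hi => by
  rw [delta_mul_coeff, hQ i hi, hQ _ (by omega), E_zero, Δ_zero, add_zero]

theorem IsDiff.delta_pow_mul {Q : Op T 𝕜} (hQ : IsDiff Q) (n : ℕ) :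
    IsDiff (mono 1 1 ^ n * Q) := by
  induction n with
  | zero => rwa [pow_zero, one_mul]
  | succ n ih =>
    rw [pow_succ', mul_assoc]
    exact ih.delta_mul

theorem isDiff_projGE {k : ℤ} (hk : 0 ≤ k) (P : Op T 𝕜) : IsDiff (projGE k P) :=
  fun _ hi => if_neg (by omega)

theorem mono_eq_delta_pow (n : ℕ) (f : Smooth T 𝕜) :
    mono (n : ℤ) f = mono 0 f * mono 1 1 ^ n := by
  have h : ∀ m : ℕ, mono (m : ℤ) 1 = (mono 1 1 ^ m : Op T 𝕜) := fun m => by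
    induction m with
    | zero => rw [pow_zero]; rfl
    | succ m ih =>
      rw [pow_succ', ← ih, ← mul_one (mono (m : ℤ) 1), delta_mul_mono_mul, mul_one]
      rfl
  rw [← h, ← mul_one (mono (n : ℤ) 1), ← mono_mul, mul_one]

theorem mono_zero_mul_mono_zero (f g : Smooth T 𝕜) :
    mono 0 f * mono 0 g = mono 0 (f * g) := Op.ext fun m => by
  rw [mono_zero_mul_coeff, mono_coeff, mono_coeff, mul_ite, mul_zero]

theorem IsDiff.eq_sum {P : Op T 𝕜} (hP : IsDiff P) {a : ℕ} (ha : OrdLE a P) :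
    P = ∑ i ∈ Finset.range (a + 1), mono 0 (P.1 i) * mono 1 1 ^ i := by
  refine Op.ext fun m => ?_
  simp only [← mono_eq_delta_pow, coe_sum, mono_coeff]
  by_cases hm : 0 ≤ m ∧ m ≤ a
  · obtain ⟨n, rfl⟩ := Int.eq_ofNat_of_zero_le hm.1
    rw [Finset.sum_eq_single_of_mem n (Finset.mem_range.2 (by omega)), if_pos rfl]
    intro j _ hj
    rw [if_neg (by omega)]
  · rw [Finset.sum_eq_zero]
    · by_cases h0 : m < 0
      · exact hP m h0
      · exact ha m (by omega)
    · intro j hj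
      have := Finset.mem_range.1 hj
      rw [if_neg (by omega)]

theorem exists_nat_ordLE (P : Op T 𝕜) : ∃ a : ℕ, OrdLE a P := by
  obtain ⟨a, ha⟩ := exists_ordLE P
  exact ⟨a.toNat, ha.mono (Int.self_le_toNat a)⟩

theorem IsDiff.mul {P Q : Op T 𝕜} (hP : IsDiff P) (hQ : IsDiff Q) : IsDiff (P * Q) := by
  obtain ⟨a, ha⟩ := exists_nat_ordLE P
  rw [hP.eq_sum ha, Finset.sum_mul]
  refine IsDiff.sum fun i _ => ?_
  rw [mul_assoc]
  exact (hQ.delta_pow_mul i).mono_zero_mul _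

theorem delta_mul_mono_zero (f : Smooth T 𝕜) :
    mono 1 1 * mono 0 f = mono 0 (E f) * mono 1 1 + mono 0 (Δ f) := by
  rw [delta_mul_mono, zero_add, ← pow_one (mono 1 1), ← mono_eq_delta_pow]
  rfl

theorem mono_zero_mul_delta (f : Smooth T 𝕜) :
    mono 0 f * mono 1 1 = mono 1 1 * mono 0 (Einv f) + mono 0 (-Δ (Einv f)) := by
  rw [delta_mul_mono_zero, E_Einv, mono_neg, add_neg_cancel_right]

theorem exists_delta_pow_mul (n : ℕ) (f : Smooth T 𝕜) :
    ∃ D, IsDiff D ∧ mono 1 1 ^ n * mono 0 f = D * mono 1 1 + mono 0 (Δ^[n] f) := by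
  induction n with
  | zero => exact ⟨0, fun _ _ => rfl, by simp⟩
  | succ n ih =>
    obtain ⟨D, hD, h⟩ := ih
    refine ⟨mono 1 1 * D + mono 0 (E (Δ^[n] f)), hD.delta_mul.add (isDiff_mono_zero _), ?_⟩
    rw [pow_succ', mul_assoc, h, mul_add, delta_mul_mono_zero, Function.iterate_succ_apply',
      add_mul, mul_assoc, add_assoc]

theorem exists_mul_delta_pow (n : ℕ) (f : Smooth T 𝕜) :
    ∃ D, IsDiff D ∧ mono 0 f * mono 1 1 ^ n =
      mono 1 1 * D + mono 0 ((fun g => -Δ (Einv g))^[n] f) := by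
  induction n with
  | zero => exact ⟨0, fun _ _ => rfl, by simp⟩
  | succ n ih =>
    obtain ⟨D, hD, h⟩ := ih
    refine ⟨D * mono 1 1 + mono 0 (Einv ((fun g => -Δ (Einv g))^[n] f)),
      (hD.mul isDiff_delta).add (isDiff_mono_zero _), ?_⟩
    rw [pow_succ, ← mul_assoc, h, add_mul, mono_zero_mul_delta, Function.iterate_succ_apply',
      mul_add, mul_assoc, add_assoc]

theorem mono_zero_sum {κ : Type*} (s : Finset κ) (f : κ → Smooth T 𝕜) :
    mono 0 (∑ j ∈ s, f j) = ∑ j ∈ s, mono 0 (f j) :=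
  map_sum (AddMonoidHom.mk' (mono (𝕜 := 𝕜) (T := T) 0) (mono_add 0)) f s

theorem act_eq_sum {A : Op T 𝕜} {a : ℕ} (ha : OrdLE a A) (f : Smooth T 𝕜) :
    act A f = ∑ i ∈ Finset.range (a + 1), A.1 i * Δ^[i] f := by
  refine finsum_eq_sum_of_support_subset _ fun i hi => ?_
  rw [Function.mem_support] at hi
  by_contra h
  simp only [Finset.coe_range, Set.mem_Iio] at h
  rw [ha i (by omega), zero_mul] at hi
  exact hi rfl

theorem adjAct_eq_sum {A : Op T 𝕜} {a : ℕ} (ha : OrdLE a A) (f : Smooth T 𝕜) :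
    adjAct A f = ∑ i ∈ Finset.range (a + 1), (fun g => -Δ (Einv g))^[i] (A.1 i * f) := by
  refine finsum_eq_sum_of_support_subset _ fun i hi => ?_
  rw [Function.mem_support] at hi
  by_contra h
  simp only [Finset.coe_range, Set.mem_Iio] at h
  rw [ha i (by omega), zero_mul, Function.iterate_fixed (by rw [Einv_zero, Δ_zero, neg_zero])] at hi
  exact hi rfl

/-- Right division of `A ψ` by `δ`: the remainder is the function `A[ψ]`. -/
theorem IsDiff.exists_mul_mono {A : Op T 𝕜} (hA : IsDiff A) (f : Smooth T 𝕜) :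
    ∃ D, IsDiff D ∧ A * mono 0 f = D * mono 1 1 + mono 0 (act A f) := by
  obtain ⟨a, ha⟩ := exists_nat_ordLE A
  choose D hD h using fun i => exists_delta_pow_mul i f
  refine ⟨∑ i ∈ Finset.range (a + 1), mono 0 (A.1 i) * D i,
    IsDiff.sum fun i _ => (hD i).mono_zero_mul _, ?_⟩
  rw [act_eq_sum ha, mono_zero_sum, Finset.sum_mul, ← Finset.sum_add_distrib]
  conv_lhs => rw [hA.eq_sum ha, Finset.sum_mul]
  refine Finset.sum_congr rfl fun i _ => ?_
  rw [mul_assoc, h, mul_add, mono_zero_mul_mono_zero, mul_assoc]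

/-- Left division of `φ A` by `δ`: the remainder is the function `A†[φ]`. -/
theorem IsDiff.exists_mono_mul {A : Op T 𝕜} (hA : IsDiff A) (f : Smooth T 𝕜) :
    ∃ D, IsDiff D ∧ mono 0 f * A = mono 1 1 * D + mono 0 (adjAct A f) := by
  obtain ⟨a, ha⟩ := exists_nat_ordLE A
  choose D hD h using fun i : ℕ => exists_mul_delta_pow i (A.1 i * f)
  refine ⟨∑ i ∈ Finset.range (a + 1), D i, IsDiff.sum fun i _ => hD i, ?_⟩
  rw [adjAct_eq_sum ha, mono_zero_sum, Finset.mul_sum, ← Finset.sum_add_distrib]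
  conv_lhs => rw [hA.eq_sum ha, Finset.mul_sum]
  refine Finset.sum_congr rfl fun i _ => ?_
  rw [← mul_assoc, mono_zero_mul_mono_zero, mul_comm f, h]

theorem delta_mul_delta_inv : mono 1 1 * mono (-1) 1 = (1 : Op T 𝕜) := by
  rw [← mul_one (mono (-1) 1), delta_mul_mono_mul, mul_one]
  rfl

theorem delta_inv_mul_delta : mono (-1) 1 * mono 1 1 = (1 : Op T 𝕜) := by
  refine delta_mul_injective ?_
  rw [← mul_assoc, delta_mul_delta_inv, one_mul, mul_one]

end Differential

/-! ### The symbol at a right-scattered point -/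

section Symbol

variable {T : Regular} {𝕜 : Type*} [RCLike 𝕜]

/-- The value at `x` of the coefficients of a differential operator, with `δ` replaced by
`-1 / μ(x)`. At a right-scattered point, where `δ = μ⁻¹ (E - 1)`, this is the coefficient of `E⁰`
when the operator is written as a polynomial in `E`. Negative powers of `δ` are dropped. -/
noncomputable def symbol (x : T.Pt) (P : Op T 𝕜) : 𝕜 :=
  ∑ᶠ i : ℕ, (P.1 i).1 x * (-(μ x : 𝕜)⁻¹) ^ i

theorem symbol_eq_sum {x : T.Pt} {P : Op T 𝕜} {a : ℕ}
    (h : ∀ i : ℕ, a ≤ i → (P.1 i).1 x = 0) :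
    symbol x P = ∑ i ∈ Finset.range a, (P.1 i).1 x * (-(μ x : 𝕜)⁻¹) ^ i := by
  refine finsum_eq_sum_of_support_subset _ fun i hi => ?_
  rw [Function.mem_support] at hi
  by_contra h'
  simp only [Finset.coe_range, Set.mem_Iio, not_lt] at h'
  rw [h i h', zero_mul] at hi
  exact hi rfl

theorem symbol_eq_sum_of_ordLE (x : T.Pt) {P : Op T 𝕜} {a b : ℕ} (h : OrdLE a P) (hb : a < b) :
    symbol x P = ∑ i ∈ Finset.range b, (P.1 i).1 x * (-(μ x : 𝕜)⁻¹) ^ i :=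
  symbol_eq_sum fun i hi => by
    rw [h i (by omega)]
    rfl

theorem symbol_add (x : T.Pt) (P Q : Op T 𝕜) : symbol x (P + Q) = symbol x P + symbol x Q := by
  obtain ⟨a, ha⟩ := exists_nat_ordLE P
  obtain ⟨b, hb⟩ := exists_nat_ordLE Q
  have ha' : OrdLE ((max a b : ℕ) : ℤ) P := ha.mono (by omega)
  have hb' : OrdLE ((max a b : ℕ) : ℤ) Q := hb.mono (by omega)
  rw [symbol_eq_sum_of_ordLE x ha' (Nat.lt_succ_self _),
    symbol_eq_sum_of_ordLE x hb' (Nat.lt_succ_self _),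
    symbol_eq_sum_of_ordLE x (ha'.add hb') (Nat.lt_succ_self _), ← Finset.sum_add_distrib]
  exact Finset.sum_congr rfl fun i _ => add_mul _ _ _

theorem symbol_sub (x : T.Pt) (P Q : Op T 𝕜) : symbol x (P - Q) = symbol x P - symbol x Q := by
  rw [eq_sub_iff_add_eq, ← symbol_add, sub_add_cancel]

theorem symbol_sum (x : T.Pt) {κ : Type*} (s : Finset κ) (P : κ → Op T 𝕜) :
    symbol x (∑ j ∈ s, P j) = ∑ j ∈ s, symbol x (P j) :=
  map_sum (AddMonoidHom.mk' (symbol (𝕜 := 𝕜) x) (symbol_add x)) P s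

theorem symbol_of_ordLE_neg (x : T.Pt) {P : Op T 𝕜} (h : OrdLE (-1) P) : symbol x P = 0 := by
  rw [symbol_eq_sum (a := 0) fun i _ => by rw [h i (by omega)]; rfl, Finset.sum_range_zero]

theorem symbol_mono_zero_mul (x : T.Pt) (f : Smooth T 𝕜) (Q : Op T 𝕜) :
    symbol x (mono 0 f * Q) = f.1 x * symbol x Q := by
  obtain ⟨a, ha⟩ := exists_nat_ordLE Q
  rw [symbol_eq_sum_of_ordLE x (P := mono 0 f * Q) (a := a) (fun i hi => by
      rw [mono_zero_mul_coeff, ha i hi, mul_zero]) (Nat.lt_succ_self _),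
    symbol_eq_sum_of_ordLE x ha (Nat.lt_succ_self _), Finset.mul_sum]
  refine Finset.sum_congr rfl fun i _ => ?_
  rw [mono_zero_mul_coeff]
  exact mul_assoc _ _ _

theorem symbol_one (x : T.Pt) : symbol x (1 : Op T 𝕜) = 1 := by
  rw [symbol_eq_sum (a := 1) fun i hi => by
    rw [one_eq_mono, mono_coeff, if_neg (by omega)]; rfl]
  simp [one_eq_mono, mono_coeff]

/-- At a right-scattered point the delta derivative is a difference quotient. -/
theorem Δ_apply_of_ne {x : T.Pt} (hx : μ x ≠ 0) (f : Smooth T 𝕜) :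
    (Δ f).1 x = (μ x : 𝕜)⁻¹ * ((E f).1 x - f.1 x) := by
  have h : x ≠ σ T x := fun h => hx (by unfold μ; rw [← h, sub_self])
  have h1 := (rawDelta_spec (deltaDiff f) x).mono_left (pure_le_nhdsWithin (s := {σ T x}ᶜ) h)
  rw [← div_eq_inv_mul]
  exact tendsto_nhds_unique h1 (tendsto_pure_nhds _ x)

theorem symbol_delta_mul {x : T.Pt} (hx : μ x ≠ 0) {Q : Op T 𝕜} (hQ : IsDiff Q) :
    symbol x (mono 1 1 * Q) = -(μ x : 𝕜)⁻¹ * symbol x Q := by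
  obtain ⟨a, ha⟩ := exists_nat_ordLE Q
  have h1 : OrdLE ((a + 1 : ℕ) : ℤ) (mono 1 1 * Q) :=
    ((ordLE_mono 1 1).mul ha).mono (by push_cast; omega)
  rw [symbol_eq_sum_of_ordLE x h1 (Nat.lt_succ_self _),
    symbol_eq_sum_of_ordLE x ha (Nat.lt_succ_self _), Finset.mul_sum]
  simp only [delta_mul_coeff]
  have h2 : ∀ i : ℕ, (E (Q.1 ((i : ℤ) - 1)) + Δ (Q.1 i)).1 x * (-(μ x : 𝕜)⁻¹) ^ i =
      (E (Q.1 ((i : ℤ) - 1))).1 x * (-(μ x : 𝕜)⁻¹) ^ i +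
        (Δ (Q.1 i)).1 x * (-(μ x : 𝕜)⁻¹) ^ i := fun i => add_mul _ _ _
  simp only [h2]
  rw [Finset.sum_add_distrib, Finset.sum_range_succ', Finset.sum_range_succ (n := a + 1),
    hQ (((0 : ℕ) : ℤ) - 1) (by omega), ha ((a + 1 : ℕ) : ℤ) (by omega), E_zero, Δ_zero]
  change _ + 0 * _ + (_ + 0 * _) = _
  rw [zero_mul, zero_mul, add_zero, add_zero, ← Finset.sum_add_distrib]
  refine Finset.sum_congr rfl fun i _ => ?_
  rw [show ((i + 1 : ℕ) : ℤ) - 1 = i by push_cast; ring, Δ_apply_of_ne hx, pow_succ]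
  ring

theorem symbol_delta_pow_mul {x : T.Pt} (hx : μ x ≠ 0) {Q : Op T 𝕜} (hQ : IsDiff Q) (n : ℕ) :
    symbol x (mono 1 1 ^ n * Q) = (-(μ x : 𝕜)⁻¹) ^ n * symbol x Q := by
  induction n with
  | zero => rw [pow_zero, one_mul, pow_zero, one_mul]
  | succ n ih =>
    rw [pow_succ', mul_assoc, symbol_delta_mul hx (hQ.delta_pow_mul n), ih, pow_succ', mul_assoc]

/-- The symbol at a right-scattered point is a character of the algebra of differential
operators. -/
theorem symbol_mul {x : T.Pt} (hx : μ x ≠ 0) {P Q : Op T 𝕜} (hP : IsDiff P) (hQ : IsDiff Q) :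
    symbol x (P * Q) = symbol x P * symbol x Q := by
  obtain ⟨a, ha⟩ := exists_nat_ordLE P
  conv_lhs => rw [hP.eq_sum ha, Finset.sum_mul]
  rw [symbol_eq_sum_of_ordLE x ha (Nat.lt_succ_self _), symbol_sum, Finset.sum_mul]
  refine Finset.sum_congr rfl fun i _ => ?_
  rw [mul_assoc, symbol_mono_zero_mul, symbol_delta_pow_mul hx hQ, mul_assoc]

theorem symbol_mono_zero (x : T.Pt) (f : Smooth T 𝕜) : symbol x (mono 0 f) = f.1 x := by
  rw [← mul_one (mono 0 f), symbol_mono_zero_mul, symbol_one, mul_one]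

theorem symbol_delta {x : T.Pt} (hx : μ x ≠ 0) :
    symbol x (mono 1 1 : Op T 𝕜) = -(μ x : 𝕜)⁻¹ := by
  have h := symbol_delta_mul hx (isDiff_mono_zero (1 : Smooth T 𝕜))
  rwa [← one_eq_mono, mul_one, symbol_one, mul_one] at h

theorem symbol_comm {x : T.Pt} (hx : μ x ≠ 0) {P Q : Op T 𝕜} (hP : IsDiff P) (hQ : IsDiff Q) :
    symbol x (comm P Q) = 0 := by
  rw [comm, symbol_sub, symbol_mul hx hP hQ, symbol_mul hx hQ hP, mul_comm, sub_self]

theorem ordLE_source (f g : Smooth T 𝕜) : OrdLE (-1) (mono (-1) f * mono 0 g) :=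
  ((ordLE_mono (-1) f).mul (ordLE_mono 0 g)).mono (by omega)

/-- The symbol of a commutator with `ψ δ⁻¹ φ` is, up to the factor `-1 / μ`, minus the diagonal
value of the kernel of its nonlocal part: the two together make up the commutator's coefficient of
`E⁰` at `x`, and that of a commutator vanishes. -/
theorem symbol_comm_source {x : T.Pt} (hx : μ x ≠ 0) {A : Op T 𝕜} (hA : IsDiff A)
    (f g : Smooth T 𝕜) :
    -(μ x : 𝕜)⁻¹ * symbol x (comm A (mono (-1) f * mono 0 g)) =
      -((act A f).1 x * g.1 x - f.1 x * (adjAct A g).1 x) := by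
  obtain ⟨D, hD, hDA⟩ := hA.exists_mul_mono f
  obtain ⟨D', hD', hDA'⟩ := hA.exists_mono_mul g
  have h1 : A * (mono (-1) f * mono 0 g) =
      D * mono 0 g + mono (-1) (act A f) * mono 0 g := by
    rw [mono_mul, ← mul_assoc, hDA, add_mul, mul_assoc D, ← mul_assoc (mono 1 1),
      delta_mul_delta_inv, one_mul, mono_mul (-1) (act A f)]
  have h2 : mono (-1) f * mono 0 g * A =
      mono 0 f * D' + mono (-1) f * mono 0 (adjAct A g) := by
    rw [mul_assoc, hDA', mono_mul, mul_add, ← mul_assoc (mono (-1) 1), delta_inv_mul_delta,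
      one_mul, mul_add, ← mono_mul]
  have h3 := congrArg (symbol x) hDA
  have h4 := congrArg (symbol x) hDA'
  rw [symbol_add, symbol_mul hx hA (isDiff_mono_zero f), symbol_mul hx hD isDiff_delta] at h3
  rw [symbol_add, symbol_mono_zero_mul, symbol_delta_mul hx hD'] at h4
  simp only [symbol_mono_zero, symbol_delta hx] at h3 h4
  rw [comm, h1, h2, symbol_sub, symbol_add, symbol_add, symbol_of_ordLE_neg x (ordLE_source _ _),
    symbol_of_ordLE_neg x (ordLE_source _ _), symbol_mono_zero_mul,
    symbol_mul hx hD (isDiff_mono_zero g)]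
  simp only [symbol_mono_zero]
  linear_combination g.1 x * (-h3) + f.1 x * h4

end Symbol

/-! ### Finite-field Lax operators -/

section Lax

variable {T : Regular} {𝕜 : Type*} [RCLike 𝕜] {ι : Type*} [Fintype ι]

theorem comm_add (A P Q : Op T 𝕜) : comm A (P + Q) = comm A P + comm A Q := by
  unfold comm
  noncomm_ring

theorem comm_sum {κ : Type*} (A : Op T 𝕜) (s : Finset κ) (P : κ → Op T 𝕜) :
    comm A (∑ j ∈ s, P j) = ∑ j ∈ s, comm A (P j) :=
  map_sum (AddMonoidHom.mk' (comm A) (comm_add A)) P s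

theorem ordLE_sourceOp (ψ φ : ι → Smooth T 𝕜) : OrdLE (-1) (sourceOp ψ φ) :=
  OrdLE.sum fun _ _ => ordLE_source _ _

theorem symbol_comm_sourceOp {x : T.Pt} (hx : μ x ≠ 0) {A : Op T 𝕜} (hA : IsDiff A)
    (ψ φ : ι → Smooth T 𝕜) :
    -(μ x : 𝕜)⁻¹ * symbol x (comm A (sourceOp ψ φ)) = -commKernel A ψ φ x x := by
  rw [sourceOp, comm_sum, symbol_sum, Finset.mul_sum, commKernel, ← Finset.sum_neg_distrib]
  exact Finset.sum_congr rfl fun s _ => symbol_comm_source hx hA _ _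

theorem symbol_comm_lax0 {x : T.Pt} (hx : μ x ≠ 0) {A : Op T 𝕜} (hA : IsDiff A) {N : ℕ}
    (c : Smooth T 𝕜) (u : Fin N → Smooth T 𝕜) (ψ φ : ι → Smooth T 𝕜) :
    -(μ x : 𝕜)⁻¹ * symbol x (comm A (lax0 c u ψ φ)) = -commKernel A ψ φ x x := by
  rw [lax0, comm_add, symbol_add,
    symbol_comm hx hA ((isDiff_mono N c).add (IsDiff.sum fun i _ => isDiff_mono _ (u i))),
    zero_add, symbol_comm_sourceOp hx hA]

/-- An operator `A` of the form `B δ` annihilates the constants. -/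
theorem act_projGE_one (P : Op T 𝕜) : act (projGE 1 P) 1 = 0 := by
  refine finsum_eq_zero_of_forall_eq_zero fun i => ?_
  cases i with
  | zero => exact zero_mul _
  | succ i =>
    rw [Function.iterate_succ_apply, Δ_one, Function.iterate_fixed Δ_zero, mul_zero]

theorem symbol_comm_lax1 {x : T.Pt} (hx : μ x ≠ 0) {A : Op T 𝕜} (hA : IsDiff A)
    (hA1 : act A 1 = 0) {N : ℕ} (u : Fin (N + 1) → Smooth T 𝕜) (w : Smooth T 𝕜)
    (ψ φ : ι → Smooth T 𝕜) :
    -(μ x : 𝕜)⁻¹ * symbol x (comm A (lax1 u w ψ φ)) =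
      -(-(adjAct A w).1 x + commKernel A ψ φ x x) := by
  have h := symbol_comm_source hx hA 1 w
  have h0 : (act A 1).1 x = 0 := by rw [hA1]; rfl
  have h1 : (1 : Smooth T 𝕜).1 x = 1 := rfl
  rw [h0, h1] at h
  rw [lax1, comm_add, comm_add, symbol_add, symbol_add,
    symbol_comm hx hA (IsDiff.sum fun i _ => isDiff_mono _ (u i)), zero_add, mul_add, h,
    symbol_comm_sourceOp hx hA]
  ring

theorem sum_mono_coeff {M : ℕ} (u : Fin M → Smooth T 𝕜) (i : Fin M) :
    (∑ j : Fin M, mono (j : ℕ) (u j)).1 (i : ℕ) = u i := by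
  rw [coe_sum, Finset.sum_eq_single_of_mem i (Finset.mem_univ i), mono_coeff, if_pos rfl]
  intro j _ hj
  rw [mono_coeff, if_neg fun h => hj (Fin.ext (by omega))]

theorem ordLE_sum_mono {M : ℕ} (u : Fin M → Smooth T 𝕜) :
    OrdLE (M - 1) (∑ j : Fin M, mono (j : ℕ) (u j)) :=
  OrdLE.sum fun j _ => (ordLE_mono _ _).mono (by omega)

theorem lax0_coeff {N : ℕ} (c : Smooth T 𝕜) (u : Fin N → Smooth T 𝕜) (ψ φ : ι → Smooth T 𝕜)
    (i : Fin N) : (lax0 c u ψ φ).1 (i : ℕ) = u i := by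
  change (mono (N : ℤ) c).1 (i : ℕ) + (∑ j : Fin N, mono (j : ℕ) (u j)).1 (i : ℕ) +
    (sourceOp ψ φ).1 (i : ℕ) = u i
  rw [sum_mono_coeff, ordLE_sourceOp ψ φ _ (by omega), mono_coeff, if_neg (by omega), zero_add,
    add_zero]

theorem lax0_coeff_of_le {N : ℕ} (c : Smooth T 𝕜) (u : Fin N → Smooth T 𝕜)
    (ψ φ : ι → Smooth T 𝕜) {i : ℕ} (hi : N ≤ i) :
    (lax0 c u ψ φ).1 i = (mono (N : ℤ) c).1 i := by
  change (mono (N : ℤ) c).1 i + (∑ j : Fin N, mono (j : ℕ) (u j)).1 i +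
    (sourceOp ψ φ).1 i = _
  rw [ordLE_sum_mono u _ (by omega), ordLE_sourceOp ψ φ _ (by omega), add_zero, add_zero]

theorem ordLE_lax0 {N : ℕ} (c : Smooth T 𝕜) (u : Fin N → Smooth T 𝕜) (ψ φ : ι → Smooth T 𝕜) :
    OrdLE N (lax0 c u ψ φ) :=
  ((ordLE_mono _ c).add ((ordLE_sum_mono u).mono (by omega))).add
    ((ordLE_sourceOp ψ φ).mono (by omega))

theorem lax1_coeff {N : ℕ} (u : Fin (N + 1) → Smooth T 𝕜) (w : Smooth T 𝕜)
    (ψ φ : ι → Smooth T 𝕜) (i : Fin (N + 1)) : (lax1 u w ψ φ).1 (i : ℕ) = u i := by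
  change (∑ j : Fin (N + 1), mono (j : ℕ) (u j)).1 (i : ℕ) +
    (mono (-1) 1 * mono 0 w).1 (i : ℕ) + (sourceOp ψ φ).1 (i : ℕ) = u i
  rw [sum_mono_coeff, ordLE_sourceOp ψ φ _ (by omega), ordLE_source 1 w _ (by omega),
    add_zero, add_zero]

theorem ordLE_lax1 {N : ℕ} (u : Fin (N + 1) → Smooth T 𝕜) (w : Smooth T 𝕜)
    (ψ φ : ι → Smooth T 𝕜) : OrdLE N (lax1 u w ψ φ) :=
  (((ordLE_sum_mono u).mono (by push_cast; omega)).add ((ordLE_source 1 w).mono (by omega))).add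
    ((ordLE_sourceOp ψ φ).mono (by omega))

theorem jump_eq_of_μ_eq_zero {x : T.Pt} (hx : μ x = 0) : σ T x = x :=
  Subtype.ext (sub_eq_zero.1 hx)

/-- The weighted sum in the conservation law: at a right-dense point only the leading coefficient
`v m` is left; at a right-scattered one the sum is `(-μ)ᵐ` times a polynomial in `-1 / μ`. -/
theorem weighted_sum_eq_zero {m : ℕ} {r : 𝕜} {v : Fin (m + 1) → 𝕜} {K : 𝕜}
    (h0 : r = 0 → v (Fin.last m) = 0)
    (h1 : r ≠ 0 → -r⁻¹ * ∑ i, v i * (-r⁻¹) ^ (i : ℕ) = -K) :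
    ∑ i : Fin (m + 1), (-r) ^ (m - (i : ℕ)) * v i + (-r) ^ (m + 1) * K = 0 := by
  by_cases hr : r = 0
  · rw [hr, neg_zero, zero_pow (Nat.succ_ne_zero m), zero_mul, add_zero, Fin.sum_univ_castSucc,
      Finset.sum_eq_zero fun i _ => ?_, Fin.val_last, h0 hr, mul_zero, add_zero]
    rw [Fin.val_castSucc, zero_pow (by omega), zero_mul]
  · have hz : -r * -r⁻¹ = 1 := by rw [neg_mul_neg, mul_inv_cancel₀ hr]
    have h2 : ∑ i : Fin (m + 1), (-r) ^ (m - (i : ℕ)) * v i =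
        (-r) ^ m * ∑ i, v i * (-r⁻¹) ^ (i : ℕ) := by
      rw [Finset.mul_sum]
      refine Finset.sum_congr rfl fun i _ => ?_
      have h3 : (-r) ^ m = (-r) ^ (m - (i : ℕ)) * (-r) ^ (i : ℕ) := by
        rw [← pow_add, Nat.sub_add_cancel (by omega)]
      have h4 : (-r) ^ (i : ℕ) * (-r⁻¹) ^ (i : ℕ) = 1 := by rw [← mul_pow, hz, one_pow]
      linear_combination (-r⁻¹) ^ (i : ℕ) * v i * (-h3) -
        (-r) ^ (m - (i : ℕ)) * v i * h4
    rw [h2, ← neg_neg K, ← h1 hr, pow_succ]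
    linear_combination (-(-r) ^ m * ∑ i, v i * (-r⁻¹) ^ (i : ℕ)) * hz

/-- A function on an open interval with zero derivative is constant; this is its value. -/
theorem exists_const_of_hasDerivAt_zero {X : Type*} {I : Set ℝ} (hI : IsOpen I)
    (hI' : I.OrdConnected) {F : ℝ → X → 𝕜} (hF : ∀ t ∈ I, ∀ x, HasDerivAt (fun τ => F τ x) 0 t) :
    ∃ a : X → 𝕜, ∀ t ∈ I, ∀ x, F t x = a x := by
  rcases I.eq_empty_or_nonempty with rfl | ⟨t₀, ht₀⟩
  · exact ⟨0, fun t ht => ht.elim⟩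
  · refine ⟨F t₀, fun t ht x => ?_⟩
    exact hI.is_const_of_deriv_eq_zero hI'.isPreconnected
      (fun τ hτ => (hF τ hτ x).differentiableAt.differentiableWithinAt)
      (fun τ hτ => (hF τ hτ x).deriv) ht ht₀

variable {I : Set ℝ} {N n : ℕ}

theorem LaxFlow0.hasDerivAt {c : Smooth T 𝕜} {u : Fin N → ℝ → Smooth T 𝕜}
    {ψ φ : ι → ℝ → Smooth T 𝕜} {R : ℝ → Op T 𝕜} (H : LaxFlow0 I n c u ψ φ R) {t : ℝ} (ht : t ∈ I)
    (x : T.Pt) (i : Fin N) :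
    HasDerivAt (fun τ => (u i τ).1 x)
      (((comm (projGE 0 (pow (R t) n))
        (lax0 c (fun i => u i t) (fun s => ψ s t) (fun s => φ s t))).1 (i : ℕ)).1 x) t := by
  have h := H.lax t ht (i : ℕ) x
  simp only [lax0_coeff] at h
  exact h

theorem LaxFlow0.hasDerivAt_sum {c : Smooth T 𝕜} {u : Fin N → ℝ → Smooth T 𝕜}
    {ψ φ : ι → ℝ → Smooth T 𝕜} {R : ℝ → Op T 𝕜} (H : LaxFlow0 I n c u ψ φ R) {t : ℝ} (ht : t ∈ I)
    (x : T.Pt) : HasDerivAt (fun τ => ∑ s, (ψ s τ).1 x * (φ s τ).1 x)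
      (∑ s, deriv (fun τ => (ψ s τ).1 x * (φ s τ).1 x) t) t :=
  HasDerivAt.fun_sum fun s _ => ((H.diff_ψ s t ht x).mul (H.diff_φ s t ht x)).hasDerivAt

theorem LaxFlow1.hasDerivAt {u : Fin (N + 1) → ℝ → Smooth T 𝕜} {w : ℝ → Smooth T 𝕜}
    {ψ φ : ι → ℝ → Smooth T 𝕜} {R : ℝ → Op T 𝕜} (H : LaxFlow1 I n u w ψ φ R) {t : ℝ} (ht : t ∈ I)
    (x : T.Pt) (i : Fin (N + 1)) :
    HasDerivAt (fun τ => (u i τ).1 x)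
      (((comm (projGE 1 (pow (R t) n))
        (lax1 (fun i => u i t) (w t) (fun s => ψ s t) (fun s => φ s t))).1 (i : ℕ)).1 x) t := by
  have h := H.lax t ht (i : ℕ) x
  simp only [lax1_coeff] at h
  exact h

theorem LaxFlow1.hasDerivAt_sum {u : Fin (N + 1) → ℝ → Smooth T 𝕜} {w : ℝ → Smooth T 𝕜}
    {ψ φ : ι → ℝ → Smooth T 𝕜} {R : ℝ → Op T 𝕜} (H : LaxFlow1 I n u w ψ φ R) {t : ℝ} (ht : t ∈ I)
    (x : T.Pt) : HasDerivAt (fun τ => ∑ s, (ψ s τ).1 x * (φ s τ).1 x)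
      (∑ s, deriv (fun τ => (ψ s τ).1 x * (φ s τ).1 x) t) t :=
  HasDerivAt.fun_sum fun s _ => ((H.diff_ψ s t ht x).mul (H.diff_φ s t ht x)).hasDerivAt

theorem symbol_eq_fin_sum {x : T.Pt} {P : Op T 𝕜} {M : ℕ}
    (h : ∀ i : ℕ, M ≤ i → (P.1 i).1 x = 0) :
    symbol x P = ∑ i : Fin M, (P.1 (i : ℕ)).1 x * (-(μ x : 𝕜)⁻¹) ^ (i : ℕ) := by
  rw [symbol_eq_sum h, Finset.sum_range]

theorem LaxFlow0.weighted_deriv_eq_zero {m : ℕ} {c : Smooth T 𝕜}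
    {u : Fin (m + 1) → ℝ → Smooth T 𝕜} {ψ φ : ι → ℝ → Smooth T 𝕜} {R : ℝ → Op T 𝕜}
    (H : LaxFlow0 I n c u ψ φ R) {t : ℝ} (ht : t ∈ I) (x : T.Pt) :
    ∑ i : Fin (m + 1), (-(μ x : 𝕜)) ^ (m - (i : ℕ)) * deriv (fun τ => (u i τ).1 x) t +
      (-(μ x : 𝕜)) ^ (m + 1) * ∑ s, deriv (fun τ => (ψ s τ).1 x * (φ s τ).1 x) t = 0 := by
  refine weighted_sum_eq_zero (fun hr => ?_) fun hr => ?_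
  · have hx : σ T x = x := jump_eq_of_μ_eq_zero (RCLike.ofReal_eq_zero.1 hr)
    have h := comm_projGE_coeff_of_fixed hx (H.root t ht) (ordLE_lax0 _ _ _ _) n 0
    rw [show (0 : ℤ) - 1 + (m + 1 : ℕ) = m by push_cast; ring] at h
    rw [(H.hasDerivAt ht x _).deriv]
    exact h
  · have hx : μ x ≠ 0 := RCLike.ofReal_ne_zero.1 hr
    simp only [fun i => (H.hasDerivAt ht x i).deriv]
    -- the coefficients from `δᴺ` on do not depend on the time
    rw [← symbol_eq_fin_sum fun i hi => ?_, symbol_comm_lax0 hx (isDiff_projGE le_rfl _),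
      (H.hasDerivAt_sum ht x).unique (H.nonlocal t ht x x)]
    have h := H.lax t ht i x
    simp only [lax0_coeff_of_le _ _ _ _ hi] at h
    exact h.unique (hasDerivAt_const t _)

theorem LaxFlow1.weighted_deriv_eq_zero {u : Fin (N + 1) → ℝ → Smooth T 𝕜} {w : ℝ → Smooth T 𝕜}
    {ψ φ : ι → ℝ → Smooth T 𝕜} {R : ℝ → Op T 𝕜} (H : LaxFlow1 I n u w ψ φ R) {t : ℝ} (ht : t ∈ I)
    (x : T.Pt) :
    ∑ i : Fin (N + 1), (-(μ x : 𝕜)) ^ (N - (i : ℕ)) * deriv (fun τ => (u i τ).1 x) t +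
      (-(μ x : 𝕜)) ^ (N + 1) * (deriv (fun τ => (w τ).1 x) t +
        ∑ s, deriv (fun τ => (ψ s τ).1 x * (φ s τ).1 x) t) = 0 := by
  refine weighted_sum_eq_zero (fun hr => ?_) fun hr => ?_
  · have hx : σ T x = x := jump_eq_of_μ_eq_zero (RCLike.ofReal_eq_zero.1 hr)
    have h := comm_projGE_coeff_of_fixed hx (H.root t ht) (ordLE_lax1 _ _ _ _) n 1
    rw [show (1 : ℤ) - 1 + N = N by ring] at h
    rw [(H.hasDerivAt ht x _).deriv]
    exact h
  · have hx : μ x ≠ 0 := RCLike.ofReal_ne_zero.1 hr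
    simp only [fun i => (H.hasDerivAt ht x i).deriv]
    rw [← symbol_eq_fin_sum fun i hi => ?_,
      symbol_comm_lax1 hx (isDiff_projGE zero_le_one _) (act_projGE_one _),
      ((H.diff_w t ht x).hasDerivAt.add (H.hasDerivAt_sum ht x)).unique (H.nonlocal t ht x x)]
    have h := H.lax t ht i x
    have h0 : ∀ τ, (lax1 (fun i => u i τ) (w τ) (fun s => ψ s τ) (fun s => φ s τ)).1 i = 0 :=
      fun τ => ordLE_lax1 _ _ _ _ _ (by omega)
    simp only [h0] at h
    exact h.unique (hasDerivAt_const t _)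

end Lax

end TimeScale

theorem theorem2 {𝕜 : Type*} [RCLike 𝕜] (T : TimeScale.Regular) {ι : Type*} [Fintype ι]
    (N n : ℕ) (hN : 1 ≤ N) (hn : 1 ≤ n) (I : Set ℝ) (hI : IsOpen I) (hI' : I.OrdConnected) :
    -- the case k = 0
    (∀ (c : TimeScale.Smooth T 𝕜) (u : Fin N → ℝ → TimeScale.Smooth T 𝕜)
      (ψ φ : ι → ℝ → TimeScale.Smooth T 𝕜) (R : ℝ → TimeScale.Op T 𝕜),
      TimeScale.LaxFlow0 I n c u ψ φ R →
      (∀ t ∈ I, ∀ x : T.Pt,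
        ∑ i : Fin N, (-(TimeScale.μ x : 𝕜)) ^ (N - 1 - (i : ℕ)) * deriv (fun τ => (u i τ).1 x) t
          + (-(TimeScale.μ x : 𝕜)) ^ N
            * ∑ s, deriv (fun τ => (ψ s τ).1 x * (φ s τ).1 x) t = 0) ∧
      ∃ a : T.Pt → 𝕜, ∀ t ∈ I, ∀ x : T.Pt,
        ∑ i : Fin N, (-(TimeScale.μ x : 𝕜)) ^ (N - 1 - (i : ℕ)) * (u i t).1 x
          + (-(TimeScale.μ x : 𝕜)) ^ N * ∑ s, (ψ s t).1 x * (φ s t).1 x = a x) ∧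
    -- the case k = 1
    (∀ (u : Fin (N + 1) → ℝ → TimeScale.Smooth T 𝕜) (w : ℝ → TimeScale.Smooth T 𝕜)
      (ψ φ : ι → ℝ → TimeScale.Smooth T 𝕜) (R : ℝ → TimeScale.Op T 𝕜),
      TimeScale.LaxFlow1 I n u w ψ φ R →
      (∀ t ∈ I, ∀ x : T.Pt,
        ∑ i : Fin (N + 1), (-(TimeScale.μ x : 𝕜)) ^ (N - (i : ℕ)) * deriv (fun τ => (u i τ).1 x) t
          + (-(TimeScale.μ x : 𝕜)) ^ (N + 1) * deriv (fun τ => (w τ).1 x) t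
          + (-(TimeScale.μ x : 𝕜)) ^ (N + 1)
            * ∑ s, deriv (fun τ => (ψ s τ).1 x * (φ s τ).1 x) t = 0) ∧
      ∃ a : T.Pt → 𝕜, ∀ t ∈ I, ∀ x : T.Pt,
        ∑ i : Fin (N + 1), (-(TimeScale.μ x : 𝕜)) ^ (N - (i : ℕ)) * (u i t).1 x
          + (-(TimeScale.μ x : 𝕜)) ^ (N + 1) * (w t).1 x
          + (-(TimeScale.μ x : 𝕜)) ^ (N + 1) * ∑ s, (ψ s t).1 x * (φ s t).1 x = a x) := by
  refine ⟨fun c u ψ φ R H => ?_, fun u w ψ φ R H => ?_⟩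
  · obtain ⟨m, rfl⟩ : ∃ m, N = m + 1 := ⟨N - 1, by omega⟩
    refine ⟨fun t ht x => H.weighted_deriv_eq_zero ht x,
      TimeScale.exists_const_of_hasDerivAt_zero hI hI' fun t ht x => ?_⟩
    rw [← H.weighted_deriv_eq_zero ht x]
    exact (HasDerivAt.fun_sum fun i _ =>
      ((H.diff_u i t ht x).hasDerivAt.const_mul _)).add ((H.hasDerivAt_sum ht x).const_mul _)
  · refine ⟨fun t ht x => ?_, TimeScale.exists_const_of_hasDerivAt_zero hI hI' fun t ht x => ?_⟩
    · rw [add_assoc, ← mul_add]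
      exact H.weighted_deriv_eq_zero ht x
    · rw [← H.weighted_deriv_eq_zero ht x, mul_add, ← add_assoc]
      exact ((HasDerivAt.fun_sum fun i _ =>
        ((H.diff_u i t ht x).hasDerivAt.const_mul _)).add
          ((H.diff_w t ht x).hasDerivAt.const_mul _)).add ((H.hasDerivAt_sum ht x).const_mul _)
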